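/- Let $5\le d\le 7$ and $N\ge 2$ be integers. Let $f_m,H_m\in L^1(\mathbb R^d)\cap L^2(\mathbb R^d)$, $1\le m\le N$, be real valued, with $f_m$ not a.e. zero for at least one $m$, and suppose that $$H^2:=\sum_{m=1}^N\|H_m\|_{L^1(\mathbb R^d)}^2>0,\qquad Q^2:=\sum_{m=1}^N\|H_m\|_{L^2(\mathbb R^d)}^2>0 .$$ Let $H^4(\mathbb R^d)$ be the space of real valued $\phi\in L^2(\mathbb R^d)$ with $\Delta^2\phi\in L^2(\mathbb R^d)$ (in the sense of distributions), with $\|\phi\|_{H^4}^2=\|\phi\|_{L^2}^2+\|\Delta^2\phi\|_{L^2}^2$, and for $u=(u_1,\dots,u_N)$ put $\|u\|_{H^4}^2=\sum_{m}\|u_m\|_{H^4}^2$. For $\rho\in(0,1]$ let $B_\rho=\{u\in H^4(\mathbb R^d,\mathbb R^N):\|u\|_{H^4}\le\rho\}$. Let $c_e$ be a constant of the Sobolev embedding, $\|\phi\|_{L^\infty}\le c_e\|\phi\|_{H^4}$ for all $\phi\in H^4(\mathbb R^d)$ (that is, any number not smaller than the optimal constant). Let $u_0\in H^4(\mathbb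 R^d,\mathbb R^N)$ be the solution of $[-\Delta+\Delta^2]u_{0,m}=f_m$, $1\le m\le N$, and let $$I=\{z\in\mathbb R^N:\ |z|\le c_e\|u_0\|_{H^4}+c_e\}.$$ For $g=(g_1,\dots,g_N)\in C^2(I,\mathbb R^N)$ let $\|g\|_{C^2(I,\mathbb R^N)}=\sum_m\|g_m\|_{C^2(I)}$, where $$\|g_m\|_{C^2(I)}=\max_I|g_m|+\sum_{n}\max_I\Big|\frac{\partial g_m}{\partial z_n}\Big|+\sum_{n,l}\max_I\Big|\frac{\partial^2g_m}{\partial z_n\partial z_l}\Big| .$$ Let $M>0$ and let $g_1,g_2:\mathbb R^N\to\mathbb R^N$ be two vector functions of class $C^2$ on $I$, each of which has all its components and their gradients equal to zero at the origin, does not vanish identically on $I$, and has $\|g_j\|_{C^2(I,\mathbb R^N)}\le M$. Let $\varepsilon_1,\dots,\varepsilon_N\ge0$, $\varepsilon:=\max_m\varepsilon_m$, $0<\rho\le1$, and let $|S^d|$ denote the surface measure of the unit sphere in $\mathbb R^d$. Put $$A:=H^2(\|u_0\|_{H^4}+1)^{\frac8d-2}\Big(\frac{|S^d|}{4}\Big)^{\frac4d}\frac{d}{(d-4)(2\pi)^4}+Q^2,\qquad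 \kappa:=M(\|u_0\|_{H^4}+1)A^{1/2},$$ and suppose that $$0<\varepsilon\le\frac{\rho}{M(\|u_0\|_{H^4}+1)^2}\,A^{-1/2}.$$ Then, for $j=1,2$, the system $$[-\Delta+\Delta^2]u_m(x)=\varepsilon_m\int_{\mathbb R^d}H_m(x-y)\,g_{j,m}(u_0(y)+v(y))\,dy,\qquad 1\le m\le N,$$ has for every $v\in B_\rho$ a unique solution $u=:T_{g_j}v$ in $H^4(\mathbb R^d,\mathbb R^N)$, the map $T_{g_j}$ so defined is a strict contraction of $B_\rho$ into itself in the $H^4$ norm, it has a unique fixed point $u_{p,j}\in B_\rho$, and $u_j:=u_0+u_{p,j}$ solves $$[\Delta-\Delta^2]u_m(x)+\varepsilon_m\int_{\mathbb R^d}H_m(x-y)\,g_{j,m}(u(y))\,dy+f_m(x)=0,\qquad 1\le m\le N.$$ Moreover $\varepsilon\kappa<1$ and $$\|u_1-u_2\|_{H^4(\mathbb R^d,\mathbb R^N)}\le\frac{\varepsilon\kappa}{M(1-\varepsilon\kappa)}\,(\|u_0\|_{H^4(\mathbb R^d,\mathbb R^N)}+1)\,\|g_1-g_2\|_{C^2(I,\mathbb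 R^N)} .$$ -/

import Mathlib

open MeasureTheory
open scoped ENNReal SchwartzMap Laplacian

noncomputable section

/-- The space `ℝᵈ` with its Euclidean norm and Lebesgue measure. -/
abbrev Rn (d : ℕ) : Type := EuclideanSpace ℝ (Fin d)

/-- The real Hilbert space `L²(ℝᵈ)` of (classes of) real valued functions. -/
abbrev L2 (d : ℕ) : Type := Lp ℝ 2 (volume : Measure (Rn d))

/-- A function in `L²(ℝᵈ)`, regarded as a (tempered) distribution: `η ↦ ∫ η φ`. -/
def toDistr {d : ℕ} (φ : L2 d) : 𝓢'(Rn d, ℂ) :=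
  Lp.toTemperedDistribution (Complex.ofRealCLM.compLp φ)

theorem toDistr_injective {d : ℕ} : Function.Injective (toDistr (d := d)) := by
  intro φ ψ h
  have h1 : Complex.ofRealCLM.compLp φ = Complex.ofRealCLM.compLp ψ :=
    LinearMap.ker_eq_bot.1
      (congrArg id (Lp.ker_toTemperedDistributionCLM_eq_bot (E := Rn d) (F := ℂ)
        (μ := volume) (p := 2))) h
  apply Lp.ext
  filter_upwards [Complex.ofRealCLM.coeFn_compLp φ, Complex.ofRealCLM.coeFn_compLp ψ] with x hx hy
  rw [h1, hy] at hx
  simpa using hx.symm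

/-- The Sobolev space `H⁴(ℝᵈ)`: all `φ ∈ L²` whose distributional bi-Laplacian `Δ²φ` is in `L²`. -/
def H4 (d : ℕ) : Set (L2 d) :=
  {φ | ∃ ψ : L2 d, Δ (Δ (toDistr φ)) = toDistr ψ}

open Classical in
/-- `Δ²φ ∈ L²(ℝᵈ)` for `φ ∈ H⁴(ℝᵈ)` (and `0` for all other `φ`). -/
def bilaplacian {d : ℕ} (φ : L2 d) : L2 d :=
  if h : ∃ ψ : L2 d, Δ (Δ (toDistr φ)) = toDistr ψ then h.choose else 0

theorem bilaplacian_eq {d : ℕ} {φ ψ : L2 d} (h : Δ (Δ (toDistr φ)) = toDistr ψ) :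
    bilaplacian φ = ψ := by
  have h' : ∃ ψ : L2 d, Δ (Δ (toDistr φ)) = toDistr ψ := ⟨ψ, h⟩
  rw [bilaplacian, dif_pos h']
  exact toDistr_injective (h'.choose_spec.symm.trans h)

/-- `‖φ‖_{H⁴} = (‖φ‖²_{L²} + ‖Δ²φ‖²_{L²})^{1/2}`. -/
def normH4 {d : ℕ} (φ : L2 d) : ℝ := √(‖φ‖ ^ 2 + ‖bilaplacian φ‖ ^ 2)

/-- The space `H⁴(ℝᵈ, ℝᴺ)` of vector functions. -/
def H4Vec (d N : ℕ) : Set (Fin N → L2 d) := {u | ∀ m, u m ∈ H4 d}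

/-- The norm of `H⁴(ℝᵈ, ℝᴺ)`. -/
def normH4Vec {d N : ℕ} (u : Fin N → L2 d) : ℝ := √(∑ m, normH4 (u m) ^ 2)

/-- The closed ball `B_ρ` of `H⁴(ℝᵈ, ℝᴺ)`. -/
def ballH4 (d N : ℕ) (ρ : ℝ) : Set (Fin N → L2 d) := {u ∈ H4Vec d N | normH4Vec u ≤ ρ}

/-- The optimal constant of the Sobolev embedding `H⁴(ℝᵈ) ⊆ L^∞(ℝᵈ)`: the least `c ≥ 0` with
`‖φ‖_{L^∞} ≤ c ‖φ‖_{H⁴}` for all `φ ∈ H⁴(ℝᵈ)`. -/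
def sobolevConst (d : ℕ) : ℝ :=
  sInf {c : ℝ | 0 ≤ c ∧ ∀ φ ∈ H4 d,
    eLpNorm (φ : Rn d → ℝ) ∞ volume ≤ ENNReal.ofReal (c * normH4 φ)}

/-- `u ∈ H⁴(ℝᵈ)` solves `-Δu + Δ²u = F`, where the right side `F` lies in `L²(ℝᵈ)`. -/
def SolvesPoisson {d : ℕ} (F : Rn d → ℝ) (u : L2 d) : Prop :=
  u ∈ H4 d ∧ ∃ hF : MemLp F 2 (volume : Measure (Rn d)),
    -Δ (toDistr u) + Δ (Δ (toDistr u)) = toDistr (hF.toLp F)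

/-- The vector `u(x) ∈ ℝᴺ`. -/
def evalVec {d N : ℕ} (u : Fin N → L2 d) (x : Rn d) : Rn N :=
  WithLp.toLp 2 fun m => (u m : Rn d → ℝ) x

/-- The function `x ↦ ε ∫ H(x - y) g(w(y)) dy`, the integral production term. -/
def production {d N : ℕ} (ε : ℝ) (H : Rn d → ℝ) (g : Rn N → ℝ) (w : Rn d → Rn N) (x : Rn d) : ℝ :=
  ε * ∫ y, H (x - y) * g (w y)

/-- `u₀` is a solution in `H⁴(ℝᵈ, ℝᴺ)` of the linear system `[-Δ + Δ²] u_{0,m} = f_m`. -/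
def SolvesLinear {d N : ℕ} (f : Fin N → Rn d → ℝ) (u₀ : Fin N → L2 d) : Prop :=
  ∀ m, SolvesPoisson (f m) (u₀ m)

/-- `u ∈ H⁴(ℝᵈ, ℝᴺ)` solves the auxiliary system
`[-Δ + Δ²] u_m(x) = ε_m ∫ H_m(x - y) g_m(u₀(y) + v(y)) dy`. -/
def SolvesAux {d N : ℕ} (ε : Fin N → ℝ) (H : Fin N → Rn d → ℝ) (g : Fin N → Rn N → ℝ)
    (u₀ v u : Fin N → L2 d) : Prop :=
  ∀ m, SolvesPoisson (production (ε m) (H m) (g m) fun y => evalVec u₀ y + evalVec v y) (u m)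

/-- `u ∈ H⁴(ℝᵈ, ℝᴺ)` solves the stationary system
`[Δ - Δ²] u_m(x) + ε_m ∫ H_m(x - y) g_m(u(y)) dy + f_m(x) = 0`. -/
def SolvesStationary {d N : ℕ} (ε : Fin N → ℝ) (H : Fin N → Rn d → ℝ) (g : Fin N → Rn N → ℝ)
    (f : Fin N → Rn d → ℝ) (u : Fin N → L2 d) : Prop :=
  ∀ m, SolvesPoisson (fun x => production (ε m) (H m) (g m) (evalVec u) x + f m x) (u m)

/-- `ε = max_m ε_m`. -/
def epsMax {N : ℕ} (ε : Fin N → ℝ) : ℝ := ⨆ m, ε m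

/-- `H² = ∑_m ‖H_m‖²_{L¹}` for `p = 1`, and `Q² = ∑_m ‖H_m‖²_{L²}` for `p = 2`. -/
def kernelSq {d N : ℕ} (p : ℝ≥0∞) (H : Fin N → Rn d → ℝ) : ℝ :=
  ∑ m, (eLpNorm (H m) p volume).toReal ^ 2

/-- The surface measure `|Sᵈ|` of the unit sphere of `ℝᵈ`. -/
def sphereMeasure (d : ℕ) : ℝ := (volume : Measure (Rn d)).toSphere.real Set.univ

/-- The closed ball `I` of `ℝᴺ` centered at `0`, of radius `c_e ‖u₀‖_{H⁴} + c_e`. -/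
def ballI {d N : ℕ} (ce : ℝ) (u₀ : Fin N → L2 d) : Set (Rn N) :=
  Metric.closedBall 0 (ce * normH4Vec u₀ + ce)

/-- `‖h‖_{C(I)} = max_{z ∈ I} |h(z)|`. -/
def normC {N : ℕ} (I : Set (Rn N)) (h : Rn N → ℝ) : ℝ := sSup ((fun z => |h z|) '' I)

/-- The partial derivative `∂h/∂z_n` on `I`. -/
def partialOn {N : ℕ} (I : Set (Rn N)) (n : Fin N) (h : Rn N → ℝ) (z : Rn N) : ℝ :=
  fderivWithin ℝ h I z (EuclideanSpace.single n 1)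

/-- The norm of `C²(I)`. -/
def normC2 {N : ℕ} (I : Set (Rn N)) (h : Rn N → ℝ) : ℝ :=
  normC I h + ∑ n, normC I (partialOn I n h) +
    ∑ n, ∑ l, normC I (partialOn I n (partialOn I l h))

/-- The norm of `C²(I, ℝᴺ)`. -/
def normC2Vec {N : ℕ} (I : Set (Rn N)) (g : Fin N → Rn N → ℝ) : ℝ := ∑ m, normC2 I (g m)

/-- The conditions on the nonlinearity `g = (g_1, …, g_N)`. -/
structure AdmissibleNonlinearity {N : ℕ} (I : Set (Rn N)) (M : ℝ) (g : Fin N → Rn N → ℝ) :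
    Prop where
  zero : ∀ m, g m 0 = 0
  grad_zero : ∀ m, fderiv ℝ (g m) 0 = 0
  contDiffOn : ∀ m, ContDiffOn ℝ 2 (g m) I
  norm_le : normC2Vec I g ≤ M
  nontrivial : ∃ z ∈ I, ∃ m, g m z ≠ 0

/-- The conditions on the influx terms `f_m` and on the kernels `H_m`. -/
structure AdmissibleData {d N : ℕ} (f H : Fin N → Rn d → ℝ) : Prop where
  f_L1 : ∀ m, MemLp (f m) 1 volume
  f_L2 : ∀ m, MemLp (f m) 2 volume
  f_nontrivial : ∃ m, ¬ f m =ᵐ[volume] 0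
  H_L1 : ∀ m, MemLp (H m) 1 volume
  H_L2 : ∀ m, MemLp (H m) 2 volume
  H_pos : 0 < kernelSq 1 H
  Q_pos : 0 < kernelSq 2 H

/-- The expression
`H² (‖u₀‖ + 1)^{8/d - 2} (|Sᵈ|/4)^{4/d} d / ((d - 4)(2π)⁴) + Q²`. -/
def bracket {d N : ℕ} (H : Fin N → Rn d → ℝ) (u₀ : Fin N → L2 d) : ℝ :=
  kernelSq 1 H * (normH4Vec u₀ + 1) ^ (8 / (d : ℝ) - 2) * (sphereMeasure d / 4) ^ (4 / (d : ℝ)) *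
    ((d : ℝ) / (((d : ℝ) - 4) * (2 * Real.pi) ^ 4)) + kernelSq 2 H

/-- The upper bound imposed on `ε`. -/
def epsBound {d N : ℕ} (M ρ : ℝ) (H : Fin N → Rn d → ℝ) (u₀ : Fin N → L2 d) : ℝ :=
  ρ / (M * (normH4Vec u₀ + 1) ^ 2) * bracket H u₀ ^ (-(1 / 2) : ℝ)

/-- The constant `κ`. -/
def kappa {d N : ℕ} (M : ℝ) (H : Fin N → Rn d → ℝ) (u₀ : Fin N → L2 d) : ℝ :=
  M * (normH4Vec u₀ + 1) * bracket H u₀ ^ (1 / 2 : ℝ)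

/-- The auxiliary system defines the map `T : B_ρ → B_ρ`: for each `v ∈ B_ρ` the vector function
`T v` is its one and only solution `u`. -/
def IsSolutionMap {d N : ℕ} {ρ : ℝ} (ε : Fin N → ℝ) (H : Fin N → Rn d → ℝ)
    (g : Fin N → Rn N → ℝ) (u₀ : Fin N → L2 d) (T : ballH4 d N ρ → ballH4 d N ρ) : Prop :=
  ∀ (v : ballH4 d N ρ) (u : Fin N → L2 d), SolvesAux ε H g u₀ v u ↔ u = T v

/-- `T` is a strict contraction of `B_ρ` in the norm of `H⁴(ℝᵈ, ℝᴺ)`. -/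
def IsStrictContraction {d N : ℕ} {ρ : ℝ} (T : ballH4 d N ρ → ballH4 d N ρ) : Prop :=
  ∃ q : ℝ, 0 ≤ q ∧ q < 1 ∧ ∀ v w : ballH4 d N ρ,
    normH4Vec ((T v).1 - (T w).1) ≤ q * normH4Vec (v.1 - w.1)

end

/-! On the Fourier side the equation -Δu + Δ²u = F reads û = F̂ / (s + s²) with s = (2π|ξ|)². The
only singularity is at the origin, where |û|² ≤ |F̂|² / s² is integrable because F ∈ L¹ makes F̂
bounded and d ≥ 5 makes |ξ|⁻⁴ locally integrable. Bounding low frequencies |ξ| < R by ‖F‖₁, high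
ones by ‖F‖₂, and Δ²u by ‖F‖₂ controls the H⁴ norm (`SolvesPoisson.normH4_sq_le`).

For F = ε H * G with ‖G‖₁ ≤ L K and ‖G‖₂ ≤ L, where K = ‖u₀‖ + 1, Young's inequality and the optimal
R turn this into ‖u‖ ≤ ε L K A^{1/2} (`exists_optimal_radius`,
`normH4Vec_le_of_solvesPoisson_conv`).

Here G is an increment g(w) - g(w'). For d ≤ 7 the Sobolev embedding keeps the values of u₀ + v in
the ball I, where the C² norm is available. The Lipschitz bound of g gives ‖G‖₂ ≤ M‖w - w'‖; the
vanishing gradient at 0 gives the quadratic bound |g(z) - g(z')| ≤ M (|z| + |z'|)/2 · |z - z'|,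
hence ‖G‖₁ ≤ M‖w - w'‖ K (`increment_estimates`). So L = M‖w - w'‖ and the Lipschitz constant of T
is εκ. Comparison with w' = 0 bounds ‖Tv‖ by εκK, which the smallness of ε makes at most ρ ≤ 1.
Since u₀ ≠ 0, K > 1 and therefore εκ < 1.

The ball B_ρ is complete because the graph of Δ² is closed, so Banach's fixed point theorem applies.
For stability, T₁v - T₂v solves the same system with nonlinearity g₁ - g₂, and the self-map
estimate, with M replaced by the norm of g₁ - g₂, is combined with the contraction property. -/

open scoped FourierTransform ComplexConjugate

noncomputable section

/-! ### The Laplacian as a Fourier multiplier on L²; sup bounds for transforms; real parts. -/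

section FourierSide

variable {d : ℕ}

/-- The complex Hilbert space `L²(ℝᵈ, ℂ)`. -/
abbrev CL2 (d : ℕ) : Type := Lp ℂ 2 (volume : Measure (Rn d))

/-- A real valued `L²` function regarded as a complex valued one. -/
abbrev complexify (φ : L2 d) : CL2 d := Complex.ofRealCLM.compLp φ

/-- The real part of a complex valued `L²` function. -/
abbrev reLp (φ : CL2 d) : L2 d := Complex.reCLM.compLp φ

theorem coeFn_complexify (φ : L2 d) : ∀ᵐ x, complexify φ x = ((φ x : ℝ) : ℂ) := by
  filter_upwards [Complex.ofRealCLM.coeFn_compLp φ] with x hx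
  rw [hx]; rfl

theorem coeFn_reLp (φ : CL2 d) : ∀ᵐ x, reLp φ x = (φ x).re := by
  filter_upwards [Complex.reCLM.coeFn_compLp φ] with x hx
  rw [hx]; rfl

theorem norm_complexify (φ : L2 d) : ‖complexify φ‖ = ‖φ‖ := by
  rw [Lp.norm_def, Lp.norm_def]
  congr 1
  apply eLpNorm_congr_norm_ae
  filter_upwards [coeFn_complexify φ] with x hx
  rw [hx, Complex.norm_real]

theorem complexify_add (φ ψ : L2 d) : complexify (φ + ψ) = complexify φ + complexify ψ :=
  (Complex.ofRealCLM.compLpL 2 volume).map_add φ ψ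

theorem complexify_sub (φ ψ : L2 d) : complexify (φ - ψ) = complexify φ - complexify ψ :=
  (Complex.ofRealCLM.compLpL 2 volume).map_sub φ ψ

theorem toDistr_add (φ ψ : L2 d) : toDistr (φ + ψ) = toDistr φ + toDistr ψ := by
  change Lp.toTemperedDistribution (complexify _) = _
  rw [complexify_add]
  exact (Lp.toTemperedDistributionCLM ℂ volume 2).map_add _ _

theorem toDistr_sub (φ ψ : L2 d) : toDistr (φ - ψ) = toDistr φ - toDistr ψ := by
  change Lp.toTemperedDistribution (complexify _) = _
  rw [complexify_sub]
  exact (Lp.toTemperedDistributionCLM ℂ volume 2).map_sub _ _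

theorem continuous_toDistr : Continuous (toDistr (d := d)) :=
  (Lp.toTemperedDistributionCLM ℂ volume 2).continuous.comp
    (Complex.ofRealCLM.compLpL 2 volume).continuous

theorem toDistr_zero : toDistr (0 : L2 d) = 0 := by
  simpa using toDistr_sub (0 : L2 d) 0

/-- Equality of a multiple of one `L²` function with another one, as distributions and almost
everywhere. -/
theorem smulLeftCLM_toTemperedDistribution_eq_iff {g : Rn d → ℂ} (hg : g.HasTemperateGrowth)
    (w z : CL2 d) :
    TemperedDistribution.smulLeftCLM ℂ g (Lp.toTemperedDistribution w) =
      Lp.toTemperedDistribution z ↔ ∀ᵐ ξ, g ξ * w ξ = z ξ := by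
  constructor
  · intro h
    refine ae_eq_of_integral_contDiff_smul_eq
      (((Lp.memLp w).locallyIntegrable (by norm_num)).continuous_mul hg.1.continuous)
      ((Lp.memLp z).locallyIntegrable (by norm_num)) ?_
    intro η hη hηc
    have h1 : HasCompactSupport (Complex.ofRealCLM ∘ η) := hηc.comp_left rfl
    have h2 : ContDiff ℝ (↑(⊤ : ℕ∞)) (Complex.ofRealCLM ∘ η) := by fun_prop
    have := congrArg (fun T : 𝓢'(Rn d, ℂ) => T (h1.toSchwartzMap h2)) h
    simp only [TemperedDistribution.smulLeftCLM_apply_apply, Lp.toTemperedDistribution_apply,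
      SchwartzMap.smulLeftCLM_apply_apply hg] at this
    simp only [Complex.real_smul]
    simpa [smul_eq_mul, mul_assoc, mul_left_comm] using this
  · intro h
    ext η
    simp only [TemperedDistribution.smulLeftCLM_apply_apply, Lp.toTemperedDistribution_apply,
      SchwartzMap.smulLeftCLM_apply_apply hg]
    refine integral_congr_ae ?_
    filter_upwards [h] with x hx
    simp only [smul_eq_mul, ← hx]; ring

/-- The symbol `(2π|ξ|)²` of `-Δ`. -/
def symb (ξ : Rn d) : ℝ := (2 * Real.pi) ^ 2 * ‖ξ‖ ^ 2

theorem symb_nonneg (ξ : Rn d) : 0 ≤ symb ξ := by unfold symb; positivity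

theorem symb_pos {ξ : Rn d} (h : ξ ≠ 0) : 0 < symb ξ := by
  have := norm_pos_iff.2 h
  unfold symb; positivity

theorem continuous_symb : Continuous (symb (d := d)) := by unfold symb; fun_prop

theorem hasTemperateGrowth_symb : (fun ξ : Rn d => (symb ξ : ℂ)).HasTemperateGrowth := by
  unfold symb; fun_prop

theorem fourier_laplacian (T : 𝓢'(Rn d, ℂ)) :
    𝓕 (Δ T) = -TemperedDistribution.smulLeftCLM ℂ (fun ξ => (symb ξ : ℂ)) (𝓕 T) := by
  have h : (fun ξ : Rn d => (symb ξ : ℂ)) =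
      (((2 * Real.pi) ^ 2 : ℝ) : ℂ) • fun ξ : Rn d => Complex.ofReal (‖ξ‖ ^ 2) := by
    ext ξ; simp [symb]
  rw [TemperedDistribution.laplacian_eq_fourierMultiplierCLM, h,
    TemperedDistribution.smulLeftCLM_smul (by fun_prop),
    TemperedDistribution.fourierMultiplierCLM_apply, neg_smul,
    ← Complex.coe_smul ((2 * Real.pi) ^ 2)]
  refine ((FourierTransform.fourierCLM ℂ 𝓢'(Rn d, ℂ)).map_neg _).trans (congrArg Neg.neg ?_)
  refine ((FourierTransform.fourierCLM ℂ 𝓢'(Rn d, ℂ)).map_smul _ _).trans ?_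
  rw [FourierTransform.fourierCLM_apply, FourierTransform.fourier_fourierInv_eq]
  rfl

theorem fourier_injective : Function.Injective (𝓕 : 𝓢'(Rn d, ℂ) → 𝓢'(Rn d, ℂ)) := fun S T h => by
  rw [← FourierTransform.fourierInv_fourier_eq (F := 𝓢'(Rn d, ℂ)) S, h,
    FourierTransform.fourierInv_fourier_eq]

theorem laplacian_eq_iff (w z : CL2 d) :
    Δ (Lp.toTemperedDistribution w) = Lp.toTemperedDistribution z ↔
      ∀ᵐ ξ, (-symb ξ : ℂ) * 𝓕 w ξ = 𝓕 z ξ := by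
  rw [← smulLeftCLM_toTemperedDistribution_eq_iff (g := fun ξ => (-symb ξ : ℂ))
    hasTemperateGrowth_symb.neg, ← Lp.fourier_toTemperedDistribution_eq,
    ← Lp.fourier_toTemperedDistribution_eq, ← fourier_injective.eq_iff, fourier_laplacian]
  have := TemperedDistribution.smulLeftCLM_neg (F := ℂ) (hasTemperateGrowth_symb (d := d))
  rw [show (fun ξ : Rn d => (-symb ξ : ℂ)) = -fun ξ => (symb ξ : ℂ) from rfl, this]
  rfl

theorem bilaplacian_eq_iff (w z : CL2 d) :
    Δ (Δ (Lp.toTemperedDistribution w)) = Lp.toTemperedDistribution z ↔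
      ∀ᵐ ξ, (symb ξ : ℂ) ^ 2 * 𝓕 w ξ = 𝓕 z ξ := by
  rw [← smulLeftCLM_toTemperedDistribution_eq_iff (g := fun ξ => (symb ξ : ℂ) ^ 2)
    (hasTemperateGrowth_symb.pow 2), ← Lp.fourier_toTemperedDistribution_eq,
    ← Lp.fourier_toTemperedDistribution_eq, ← fourier_injective.eq_iff, fourier_laplacian,
    fourier_laplacian, map_neg, neg_neg,
    TemperedDistribution.smulLeftCLM_smulLeftCLM_apply hasTemperateGrowth_symb
      hasTemperateGrowth_symb]
  simp only [pow_two]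
  rfl

theorem neg_laplacian_add_bilaplacian_eq_iff (w z : CL2 d) :
    -Δ (Lp.toTemperedDistribution w) + Δ (Δ (Lp.toTemperedDistribution w)) =
      Lp.toTemperedDistribution z ↔
      ∀ᵐ ξ, ((symb ξ : ℂ) + (symb ξ : ℂ) ^ 2) * 𝓕 w ξ = 𝓕 z ξ := by
  have h1 := hasTemperateGrowth_symb (d := d)
  have h2 := h1.pow 2
  rw [← smulLeftCLM_toTemperedDistribution_eq_iff (g := fun ξ => (symb ξ : ℂ) + (symb ξ : ℂ) ^ 2)
    (h1.add h2), ← Lp.fourier_toTemperedDistribution_eq,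
    ← Lp.fourier_toTemperedDistribution_eq, ← fourier_injective.eq_iff,
    FourierTransform.fourier_add, ]
  have h3 := TemperedDistribution.smulLeftCLM_add (F := ℂ) h1 h2
  have h4 : (fun ξ : Rn d => (symb ξ : ℂ) + (symb ξ : ℂ) ^ 2) =
    (fun ξ => (symb ξ : ℂ)) + (fun ξ => (symb ξ : ℂ)) ^ 2 := rfl
  have h5 : 𝓕 (-Δ (Lp.toTemperedDistribution w)) = - 𝓕 (Δ (Lp.toTemperedDistribution w)) := by
    exact (FourierTransform.fourierCLM ℂ 𝓢'(Rn d, ℂ)).map_neg _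
  simp only [h4, h3, h5, fourier_laplacian, map_neg, neg_neg]
  rw [    TemperedDistribution.smulLeftCLM_smulLeftCLM_apply h1 h1, pow_two]
  rfl

/-- The Fourier transform of a function in `L¹ ∩ L²` is bounded by the `L¹` norm. -/
theorem norm_fourier_le_of_memLp_one (w : CL2 d) (hw : Integrable w) :
    ∀ᵐ ξ, ‖𝓕 w ξ‖ ≤ ∫ x, ‖w x‖ := by
  have hc : Continuous fun p : Rn d × Rn d => (innerₗ (Rn d) p.1) p.2 := by
    simpa using! continuous_inner
  have hcont : Continuous (𝓕 (w : Rn d → ℂ)) :=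
    VectorFourier.fourierIntegral_continuous Real.continuous_fourierChar hc hw
  -- The L² transform agrees a.e. with the Fourier integral: tested against smooth compactly
  -- supported functions, both move the transform onto the test function. The integral obviously
  -- satisfies the bound.
  have key : ∀ᵐ ξ, 𝓕 w ξ = 𝓕 (w : Rn d → ℂ) ξ := by
    refine ae_eq_of_integral_contDiff_smul_eq
      ((Lp.memLp (𝓕 w)).locallyIntegrable (by norm_num)) hcont.locallyIntegrable ?_
    intro η hη hηc
    have h1 : HasCompactSupport (Complex.ofRealCLM ∘ η) := hηc.comp_left rfl
    have h2 : ContDiff ℝ (↑(⊤ : ℕ∞)) (Complex.ofRealCLM ∘ η) := by fun_prop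
    have := congrArg (fun T : 𝓢'(Rn d, ℂ) => T (h1.toSchwartzMap h2))
      (Lp.fourier_toTemperedDistribution_eq w)
    simp only [TemperedDistribution.fourier_apply, Lp.toTemperedDistribution_apply,
      SchwartzMap.fourier_coe] at this
    have h3 := VectorFourier.integral_fourierIntegral_smul_eq_flip (μ := volume) (ν := volume)
      (L := innerₗ (Rn d)) Real.continuous_fourierChar hc
      (h1.toSchwartzMap h2).integrable hw
    rw [flip_innerₗ] at h3
    have h4 := this.symm.trans h3
    simpa using! h4
  filter_upwards [key] with ξ hξ
  rw [hξ]
  exact VectorFourier.norm_fourierIntegral_le_integral_norm _ _ _ _ _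

/-- A function in `L²` with an integrable Fourier transform is essentially bounded. -/
theorem norm_le_of_integrable_fourier (u : CL2 d) (hu : Integrable (𝓕 u : CL2 d)) :
    ∀ᵐ x, ‖u x‖ ≤ ∫ ξ, ‖𝓕 u ξ‖ := by
  set w : CL2 d := 𝓕 u with hw
  -- The inverse transform is treated as the Fourier integral for the negated inner product, so that
  -- the same duality argument applies.
  have hL : Continuous fun p : Rn d × Rn d => (-innerₗ (Rn d)) p.1 p.2 := by
    simpa using! continuous_inner.neg
  have hflip : (-innerₗ (Rn d)).flip = -innerₗ (Rn d) := by
    ext x y; simp [real_inner_comm]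
  have hinv : ∀ f : Rn d → ℂ,
      𝓕⁻ f = VectorFourier.fourierIntegral Real.fourierChar volume (-innerₗ (Rn d)) f := by
    intro f; ext x
    simp [Real.fourierInv_eq, VectorFourier.fourierIntegral]
  have hcont : Continuous (𝓕⁻ (w : Rn d → ℂ)) := by
    rw [hinv]
    exact VectorFourier.fourierIntegral_continuous Real.continuous_fourierChar hL hu
  have hwu : 𝓕⁻ w = u := FourierTransform.fourierInv_fourier_eq u
  have key : ∀ᵐ ξ, u ξ = 𝓕⁻ (w : Rn d → ℂ) ξ := by
    refine ae_eq_of_integral_contDiff_smul_eq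
      ((Lp.memLp u).locallyIntegrable (by norm_num)) hcont.locallyIntegrable ?_
    intro η hη hηc
    have h1 : HasCompactSupport (Complex.ofRealCLM ∘ η) := hηc.comp_left rfl
    have h2 : ContDiff ℝ (↑(⊤ : ℕ∞)) (Complex.ofRealCLM ∘ η) := by fun_prop
    have := congrArg (fun T : 𝓢'(Rn d, ℂ) => T (h1.toSchwartzMap h2))
      (Lp.fourierInv_toTemperedDistribution_eq w)
    simp only [TemperedDistribution.fourierInv_apply, Lp.toTemperedDistribution_apply,
      SchwartzMap.fourierInv_coe, hwu] at this
    have h3 := VectorFourier.integral_fourierIntegral_smul_eq_flip (μ := volume) (ν := volume)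
      (L := -innerₗ (Rn d)) Real.continuous_fourierChar hL
      (h1.toSchwartzMap h2).integrable hu
    rw [hflip, ← hinv, ← hinv] at h3
    have h4 := this.symm.trans h3
    simpa using h4
  filter_upwards [key] with ξ hξ
  rw [hξ, hinv]
  exact VectorFourier.norm_fourierIntegral_le_integral_norm _ _ _ _ _

/-- Complex conjugation of Schwartz functions. -/
def conjSchwartz : 𝓢(Rn d, ℂ) →L[ℝ] 𝓢(Rn d, ℂ) :=
  SchwartzMap.postcompCLM (𝕜 := ℝ) (Complex.conjCLE : ℂ →L[ℝ] ℂ)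

theorem conjSchwartz_apply (η : 𝓢(Rn d, ℂ)) (x : Rn d) : conjSchwartz η x = conj (η x) := rfl

theorem laplacian_conjSchwartz (η : 𝓢(Rn d, ℂ)) : Δ (conjSchwartz η) = conjSchwartz (Δ η) := by
  ext x
  rw [SchwartzMap.laplacian_apply, conjSchwartz_apply, SchwartzMap.laplacian_apply]
  exact ContDiffAt.laplacian_CLM_comp_left (l := (Complex.conjCLE : ℂ →L[ℝ] ℂ))
    ((η.smooth 2).contDiffAt)

theorem toDistr_reLp_apply (U : CL2 d) (η : 𝓢(Rn d, ℂ)) :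
    toDistr (reLp U) η = (Lp.toTemperedDistribution U η +
      conj (Lp.toTemperedDistribution U (conjSchwartz η))) / 2 := by
  have hint : ∀ ζ : 𝓢(Rn d, ℂ), Integrable fun x => ζ x * U x := fun ζ =>
    (ζ.memLp 2 volume).integrable_mul (Lp.memLp U)
  rw [toDistr, Lp.toTemperedDistribution_apply, Lp.toTemperedDistribution_apply,
    Lp.toTemperedDistribution_apply, ← integral_conj]
  simp only [smul_eq_mul]
  rw [← integral_add (hint η), ← integral_div]
  · refine integral_congr_ae ?_
    filter_upwards [coeFn_complexify (reLp U), coeFn_reLp U] with x h1 h2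
    rw [h1, h2, conjSchwartz_apply, map_mul, Complex.conj_conj, Complex.re_eq_add_conj]
    ring
  · exact (Complex.conjCLE : ℂ →L[ℝ] ℂ).integrable_comp (hint (conjSchwartz η))

/-- The Laplacian commutes with complex conjugation, hence with real parts. This makes real
solutions out of those obtained by Fourier inversion. -/
theorem laplacian_toDistr_reLp {U V : CL2 d}
    (h : Δ (Lp.toTemperedDistribution U) = Lp.toTemperedDistribution V) :
    Δ (toDistr (reLp U)) = toDistr (reLp V) := by
  ext η
  rw [TemperedDistribution.laplacian_apply_apply, toDistr_reLp_apply, toDistr_reLp_apply, ← h,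
    TemperedDistribution.laplacian_apply_apply, TemperedDistribution.laplacian_apply_apply,
    laplacian_conjSchwartz]

end FourierSide

/-! ### The linear equation -Δu + Δ²u = F: existence, uniqueness and the H⁴ estimate. -/

section Poisson

variable {d : ℕ}

theorem norm_sq_eq_integral_norm_sq (w : CL2 d) : ‖w‖ ^ 2 = ∫ x, ‖w x‖ ^ 2 := by
  have h := L2.inner_def (𝕜 := ℂ) w w
  rw [inner_self_eq_norm_sq_to_K] at h
  have h2 : ∀ x, inner ℂ (w x) (w x) = ((‖w x‖ ^ 2 : ℝ) : ℂ) := fun x => by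
    rw [inner_self_eq_norm_sq_to_K]; simp
  simp_rw [h2] at h
  exact Complex.ofReal_injective ((Complex.ofReal_pow _ _).trans (h.trans integral_complex_ofReal))

theorem integrable_norm_sq (w : CL2 d) : Integrable fun x => ‖w x‖ ^ 2 :=
  (Lp.memLp w).integrable_norm_pow (by norm_num)

/-- In polar coordinates this is |Sᵈ| times the integral of r^(d-5) over (0, R), finite because d ≥
5. -/
theorem integrableOn_ball_inv_norm_pow_four (hd : 5 ≤ d) {R : ℝ} (hR : 0 < R) :
    IntegrableOn (fun ξ : Rn d => (‖ξ‖ ^ 4)⁻¹) (Metric.ball 0 R) ∧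
      ∫ ξ in Metric.ball (0 : Rn d) R, (‖ξ‖ ^ 4)⁻¹ =
        sphereMeasure d * R ^ (d - 4) / ((d : ℝ) - 4) := by
  have : Nonempty (Fin d) := ⟨⟨0, by omega⟩⟩
  have hpow : ∀ y ∈ Set.Ioo 0 R, y ^ (d - 5) = y ^ (d - 1) • (y ^ 4)⁻¹ := by
    intro y hy
    have hy0 : y ≠ 0 := hy.1.ne'
    have : d - 1 = (d - 5) + 4 := by omega
    rw [this, pow_add, smul_eq_mul]
    field_simp
  constructor
  · rw [integrableOn_fun_norm_addHaar volume (f := fun y : ℝ => (y ^ 4)⁻¹), finrank_euclideanSpace_fin]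
    have : IntegrableOn (fun y : ℝ => y ^ (d - 5)) (Set.Ioo 0 R) :=
      ((continuous_pow _).integrableOn_Icc).mono_set Set.Ioo_subset_Icc_self
    exact this.congr_fun hpow measurableSet_Ioo
  · have h1 : ∫ ξ in Metric.ball (0 : Rn d) R, (‖ξ‖ ^ 4)⁻¹ =
        ∫ ξ : Rn d, (Set.Iio R).indicator (fun y : ℝ => (y ^ 4)⁻¹) ‖ξ‖ := by
      rw [← integral_indicator measurableSet_ball]
      congr 1
      ext ξ
      simp [Set.indicator]
    have h2 : ∫ y in Set.Ioi (0 : ℝ), y ^ (d - 1) • (Set.Iio R).indicator (fun y : ℝ => (y ^ 4)⁻¹) y =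
        R ^ (d - 4) / ((d : ℝ) - 4) := by
      have h3 : ∀ y : ℝ, y ^ (d - 1) • (Set.Iio R).indicator (fun y : ℝ => (y ^ 4)⁻¹) y =
          (Set.Iio R).indicator (fun y : ℝ => y ^ (d - 1) • (y ^ 4)⁻¹) y := fun y => by
        by_cases hy : y < R <;> simp [Set.indicator, hy]
      simp_rw [h3]
      rw [setIntegral_indicator measurableSet_Iio, Set.Ioi_inter_Iio,
        ← setIntegral_congr_fun measurableSet_Ioo hpow, ← integral_Ioc_eq_integral_Ioo,
        ← intervalIntegral.integral_of_le hR.le, integral_pow]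
      have : d - 5 + 1 = d - 4 := by omega
      have h4 : ((d - 5 : ℕ) : ℝ) + 1 = (d : ℝ) - 4 := by
        rw [Nat.cast_sub hd]; push_cast; ring
      rw [this, h4, zero_pow (by omega), sub_zero]
    rw [h1, integral_fun_norm_addHaar, finrank_euclideanSpace_fin, h2, sphereMeasure,
      Measure.toSphere_real_apply_univ, finrank_euclideanSpace_fin]
    simp only [smul_eq_mul, nsmul_eq_mul]
    ring

theorem norm_symb_add_sq (ξ : Rn d) :
    ‖(symb ξ : ℂ) + (symb ξ : ℂ) ^ 2‖ = symb ξ + symb ξ ^ 2 := by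
  have := symb_nonneg ξ
  rw [← Complex.ofReal_pow, ← Complex.ofReal_add, Complex.norm_real,
    Real.norm_of_nonneg (by positivity)]

/-- The square integrable function dominating `F̂ / (|2πξ|² + |2πξ|⁴)` when `|F̂| ≤ α`. -/
def quotientBound (α R : ℝ) (z : Rn d → ℂ) (ξ : Rn d) : ℝ :=
  α ^ 2 * ((2 * Real.pi) ^ 4)⁻¹ * (Metric.ball (0 : Rn d) R).indicator (fun ξ => (‖ξ‖ ^ 4)⁻¹) ξ +
    ((2 * Real.pi) ^ 4)⁻¹ * (R ^ 4)⁻¹ * ‖z ξ‖ ^ 2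

/-- Dropping s² from s + s² leaves |w|² ≤ |z|² / (2π|ξ|)⁴. Inside the ball |z| is replaced by α;
outside, |ξ|⁻⁴ is replaced by R⁻⁴ and |z|² is kept for Plancherel. -/
theorem norm_sq_le_quotientBound {α R : ℝ} (hR : 0 < R) {z : Rn d → ℂ} {ξ : Rn d} (hξ : ξ ≠ 0)
    (hz : ‖z ξ‖ ≤ α) {w : ℂ} (hw : ((symb ξ : ℂ) + (symb ξ : ℂ) ^ 2) * w = z ξ) :
    ‖w‖ ^ 2 ≤ quotientBound α R z ξ := by
  have hs := symb_pos hξ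
  have hn : (symb ξ + symb ξ ^ 2) * ‖w‖ = ‖z ξ‖ := by
    rw [← hw, norm_mul, norm_symb_add_sq]
  have h1 : symb ξ * ‖w‖ ≤ ‖z ξ‖ := by
    rw [← hn]; gcongr; nlinarith
  have h2 : ‖w‖ ^ 2 ≤ ((2 * Real.pi) ^ 4)⁻¹ * (‖ξ‖ ^ 4)⁻¹ * ‖z ξ‖ ^ 2 := by
    have h3 : (symb ξ * ‖w‖) ^ 2 ≤ ‖z ξ‖ ^ 2 := by gcongr
    have h4 : ((2 * Real.pi) ^ 4)⁻¹ * (‖ξ‖ ^ 4)⁻¹ = (symb ξ ^ 2)⁻¹ := by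
      rw [symb, ← mul_inv]; ring
    rw [h4, ← div_eq_inv_mul, le_div_iff₀ (by positivity)]
    linarith [mul_pow (symb ξ) ‖w‖ 2]
  refine h2.trans ?_
  have hξ0 : 0 < ‖ξ‖ := norm_pos_iff.2 hξ
  unfold quotientBound
  by_cases hb : ξ ∈ Metric.ball (0 : Rn d) R
  · rw [Set.indicator_of_mem hb]
    have h5 : ‖z ξ‖ ^ 2 ≤ α ^ 2 := by gcongr
    have h6 : 0 ≤ ((2 * Real.pi) ^ 4)⁻¹ * (R ^ 4)⁻¹ * ‖z ξ‖ ^ 2 := by positivity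
    have h7 : ((2 * Real.pi) ^ 4)⁻¹ * (‖ξ‖ ^ 4)⁻¹ * ‖z ξ‖ ^ 2 ≤
      ((2 * Real.pi) ^ 4)⁻¹ * (‖ξ‖ ^ 4)⁻¹ * α ^ 2 := by gcongr
    linarith
  · rw [Set.indicator_of_notMem hb, mul_zero, zero_add]
    have : R ≤ ‖ξ‖ := by simpa using hb
    gcongr

theorem integrable_quotientBound (hd : 5 ≤ d) (α : ℝ) {R : ℝ} (hR : 0 < R) (z : CL2 d) :
    Integrable (quotientBound α R z) := by
  have h := (integrable_indicator_iff measurableSet_ball).2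
    (integrableOn_ball_inv_norm_pow_four (d := d) hd hR).1
  exact (h.const_mul _).add ((integrable_norm_sq z).const_mul _)

theorem integral_quotientBound (hd : 5 ≤ d) (α : ℝ) {R : ℝ} (hR : 0 < R) (z : CL2 d) :
    ∫ ξ, quotientBound α R z ξ = ((2 * Real.pi) ^ 4)⁻¹ *
      (α ^ 2 * (sphereMeasure d * R ^ (d - 4) / ((d : ℝ) - 4)) + ‖z‖ ^ 2 * (R ^ 4)⁻¹) := by
  have hb := integrableOn_ball_inv_norm_pow_four (d := d) hd hR
  have h := (integrable_indicator_iff measurableSet_ball).2 hb.1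
  unfold quotientBound
  rw [integral_add (h.const_mul _) ((integrable_norm_sq z).const_mul _), integral_const_mul,
    integral_const_mul, integral_indicator measurableSet_ball, hb.2, ← norm_sq_eq_integral_norm_sq]
  ring

theorem integral_norm_complexify_toLp {F : Rn d → ℝ} (hF : MemLp F 2 volume) :
    ∫ x, ‖complexify (hF.toLp F) x‖ = ∫ x, |F x| := by
  refine integral_congr_ae ?_
  filter_upwards [coeFn_complexify (hF.toLp F), hF.coeFn_toLp] with x h1 h2
  rw [h1, h2, Complex.norm_real, Real.norm_eq_abs]

theorem integrable_complexify_toLp {F : Rn d → ℝ} (hF : MemLp F 2 volume)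
    (hF1 : Integrable F volume) : Integrable (complexify (hF.toLp F)) := by
  refine (hF1.ofReal (𝕜 := ℂ)).congr ?_
  filter_upwards [coeFn_complexify (hF.toLp F), hF.coeFn_toLp] with x h1 h2
  rw [h1, h2]; rfl

theorem ae_ne_zero_Rn (hd : 0 < d) : ∀ᵐ ξ : Rn d, ξ ≠ 0 := by
  have : Nonempty (Fin d) := ⟨⟨0, hd⟩⟩
  exact Measure.ae_ne volume 0

/-- The solution of `-Δu + Δ²u = F` is unique. -/
theorem SolvesPoisson.unique (hd : 0 < d) {F : Rn d → ℝ} {u u' : L2 d} (h : SolvesPoisson F u)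
    (h' : SolvesPoisson F u') : u = u' := by
  obtain ⟨-, hF, h⟩ := h
  obtain ⟨-, _, h'⟩ := h'
  have h1 := (neg_laplacian_add_bilaplacian_eq_iff _ _).1 h
  have h2 := (neg_laplacian_add_bilaplacian_eq_iff _ _).1 h'
  have h3 : 𝓕 (complexify u) = 𝓕 (complexify u') := by
    apply Lp.ext
    filter_upwards [h1, h2, ae_ne_zero_Rn hd] with ξ e1 e2 hξ
    have hs := symb_pos hξ
    have hne : (symb ξ : ℂ) + (symb ξ : ℂ) ^ 2 ≠ 0 := by
      exact_mod_cast (by positivity : symb ξ + symb ξ ^ 2 ≠ 0)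
    exact mul_left_cancel₀ hne (e1.trans e2.symm)
  apply toDistr_injective
  change Lp.toTemperedDistribution (complexify u) = Lp.toTemperedDistribution (complexify u')
  rw [← FourierTransform.fourierInv_fourier_eq (F := CL2 d) (complexify u), h3,
    FourierTransform.fourierInv_fourier_eq]

theorem SolvesPoisson.congr {F F' : Rn d → ℝ} {u : L2 d} (h : SolvesPoisson F u)
    (hFF' : F =ᵐ[volume] F') : SolvesPoisson F' u := by
  obtain ⟨h0, hF, h⟩ := h
  have hF' := (memLp_congr_ae hFF').1 hF
  exact ⟨h0, hF', by rw [h, (MemLp.toLp_eq_toLp_iff hF hF').2 hFF']⟩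

theorem laplacian_sub (S T : 𝓢'(Rn d, ℂ)) : Δ (S - T) = Δ S - Δ T := by
  simpa using! (LineDeriv.laplacianCLM ℂ (Rn d) 𝓢'(Rn d, ℂ)).map_sub S T

theorem laplacian_add (S T : 𝓢'(Rn d, ℂ)) : Δ (S + T) = Δ S + Δ T := by
  simpa using! (LineDeriv.laplacianCLM ℂ (Rn d) 𝓢'(Rn d, ℂ)).map_add S T

theorem bilaplacian_spec {φ : L2 d} (h : φ ∈ H4 d) :
    Δ (Δ (toDistr φ)) = toDistr (bilaplacian φ) := by
  obtain ⟨ψ, hψ⟩ := h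
  rw [bilaplacian_eq hψ, hψ]

theorem bilaplacian_toDistr_sub {φ φ' ψ ψ' : L2 d} (h : Δ (Δ (toDistr φ)) = toDistr ψ)
    (h' : Δ (Δ (toDistr φ')) = toDistr ψ') :
    Δ (Δ (toDistr (φ - φ'))) = toDistr (ψ - ψ') := by
  rw [toDistr_sub, laplacian_sub, laplacian_sub, h, h', toDistr_sub]

theorem bilaplacian_toDistr_add {φ φ' ψ ψ' : L2 d} (h : Δ (Δ (toDistr φ)) = toDistr ψ)
    (h' : Δ (Δ (toDistr φ')) = toDistr ψ') :
    Δ (Δ (toDistr (φ + φ'))) = toDistr (ψ + ψ') := by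
  rw [toDistr_add, laplacian_add, laplacian_add, h, h', toDistr_add]

theorem SolvesPoisson.sub {F F' : Rn d → ℝ} {u u' : L2 d} (h : SolvesPoisson F u)
    (h' : SolvesPoisson F' u') : SolvesPoisson (F - F') (u - u') := by
  obtain ⟨⟨ψ, h0⟩, hF, h⟩ := h
  obtain ⟨⟨ψ', h0'⟩, hF', h'⟩ := h'
  refine ⟨⟨_, bilaplacian_toDistr_sub h0 h0'⟩, hF.sub hF', ?_⟩
  rw [MemLp.toLp_sub hF hF', toDistr_sub, toDistr_sub, ← h, ← h', laplacian_sub, laplacian_sub]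
  abel

theorem SolvesPoisson.add {F F' : Rn d → ℝ} {u u' : L2 d} (h : SolvesPoisson F u)
    (h' : SolvesPoisson F' u') : SolvesPoisson (F + F') (u + u') := by
  obtain ⟨⟨ψ, h0⟩, hF, h⟩ := h
  obtain ⟨⟨ψ', h0'⟩, hF', h'⟩ := h'
  refine ⟨⟨_, bilaplacian_toDistr_add h0 h0'⟩, hF.add hF', ?_⟩
  rw [MemLp.toLp_add hF hF', toDistr_add, toDistr_add, ← h, ← h', laplacian_add, laplacian_add]
  abel

theorem normH4_sq (φ : L2 d) : normH4 φ ^ 2 = ‖φ‖ ^ 2 + ‖bilaplacian φ‖ ^ 2 :=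
  Real.sq_sqrt (by positivity)

theorem norm_le_normH4 (φ : L2 d) : ‖φ‖ ≤ normH4 φ :=
  Real.le_sqrt_of_sq_le (by nlinarith [sq_nonneg ‖bilaplacian φ‖])

theorem norm_bilaplacian_le_normH4 (φ : L2 d) : ‖bilaplacian φ‖ ≤ normH4 φ :=
  Real.le_sqrt_of_sq_le (by nlinarith [sq_nonneg ‖φ‖])

/-- The estimate of the solution of `-Δu + Δ²u = F` in `H⁴`, the frequencies being split at `R`. -/
theorem SolvesPoisson.normH4_sq_le (hd : 5 ≤ d) {F : Rn d → ℝ} {u : L2 d} (h : SolvesPoisson F u)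
    (hF1 : Integrable F volume) {α β γ R : ℝ} (hα : ∫ x, |F x| ≤ α)
    (hβ : (eLpNorm F 2 volume).toReal ≤ β) (hγ : (eLpNorm F 2 volume).toReal ≤ γ) (hR : 0 < R) :
    normH4 u ^ 2 ≤ ((2 * Real.pi) ^ 4)⁻¹ *
      (α ^ 2 * (sphereMeasure d * R ^ (d - 4) / ((d : ℝ) - 4)) + β ^ 2 * (R ^ 4)⁻¹) + γ ^ 2 := by
  obtain ⟨h0, hF, h⟩ := h
  have hsol := (neg_laplacian_add_bilaplacian_eq_iff _ _).1 h
  have hbi := (bilaplacian_eq_iff _ _).1 (bilaplacian_spec h0)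
  set z : CL2 d := 𝓕 (complexify (hF.toLp F)) with hz
  have hFn : ‖z‖ = (eLpNorm F 2 volume).toReal := by
    rw [hz, Lp.norm_fourier_eq, norm_complexify, Lp.norm_toLp]
  have hFα : ∀ᵐ ξ, ‖z ξ‖ ≤ α := by
    filter_upwards [norm_fourier_le_of_memLp_one _ (integrable_complexify_toLp hF hF1)] with ξ hξ
    exact hξ.trans ((integral_norm_complexify_toLp hF).le.trans hα)
  rw [normH4_sq]
  gcongr ?_ + ?_
  · calc ‖u‖ ^ 2 = ∫ ξ, ‖(𝓕 (complexify u) : CL2 d) ξ‖ ^ 2 := by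
          rw [← norm_sq_eq_integral_norm_sq, Lp.norm_fourier_eq, norm_complexify]
      _ ≤ ∫ ξ, quotientBound α R z ξ := by
          refine integral_mono_ae (integrable_norm_sq _) (integrable_quotientBound hd α hR _) ?_
          filter_upwards [hsol, hFα, ae_ne_zero_Rn (by omega : 0 < d)] with ξ e1 e2 hξ
          exact norm_sq_le_quotientBound hR hξ e2 e1
      _ ≤ _ := by
          rw [integral_quotientBound hd α hR, hFn]
          gcongr
  -- The symbol s² of Δ² is at most s + s², so no splitting of frequencies is needed here.
  · have h1 : ‖bilaplacian u‖ ≤ (eLpNorm F 2 volume).toReal := by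
      rw [← hFn, ← norm_complexify, ← Lp.norm_fourier_eq]
      refine Lp.norm_le_norm_of_ae_le ?_
      filter_upwards [hsol, hbi] with ξ e1 e2
      have := symb_nonneg ξ
      rw [← e1, ← e2, norm_mul, norm_mul, norm_symb_add_sq, norm_pow, Complex.norm_real,
        Real.norm_of_nonneg this]
      gcongr
      linarith
    exact pow_le_pow_left₀ (norm_nonneg _) (h1.trans hγ) 2

/-- For `d ≥ 5` the equation `-Δu + Δ²u = F` with `F ∈ L¹ ∩ L²` has a solution in `H⁴`. -/
theorem exists_solvesPoisson (hd : 5 ≤ d) {F : Rn d → ℝ} (hF1 : Integrable F volume)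
    (hF : MemLp F 2 volume) : ∃ u, SolvesPoisson F u := by
  set z : CL2 d := 𝓕 (complexify (hF.toLp F)) with hz
  set α := ∫ x, |F x| with hα
  have hzα : ∀ᵐ ξ, ‖z ξ‖ ≤ α := by
    filter_upwards [norm_fourier_le_of_memLp_one _ (integrable_complexify_toLp hF hF1)] with ξ hξ
    exact hξ.trans (integral_norm_complexify_toLp hF).le
  let w : Rn d → ℂ := fun ξ => ((symb ξ : ℂ) + (symb ξ : ℂ) ^ 2)⁻¹ * z ξ
  have hsymb : Measurable fun ξ : Rn d => (symb ξ : ℂ) :=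
    (Complex.continuous_ofReal.comp continuous_symb).measurable
  have hwm : AEStronglyMeasurable w volume :=
    ((hsymb.add (hsymb.pow_const 2)).inv.aestronglyMeasurable).mul
      (Lp.aestronglyMeasurable z)
  have hne : ∀ ξ : Rn d, ξ ≠ 0 → (symb ξ : ℂ) + (symb ξ : ℂ) ^ 2 ≠ 0 := fun ξ hξ => by
    have hs := symb_pos hξ
    exact_mod_cast (by positivity : symb ξ + symb ξ ^ 2 ≠ 0)
  have hwz : ∀ ξ : Rn d, ξ ≠ 0 → ((symb ξ : ℂ) + (symb ξ : ℂ) ^ 2) * w ξ = z ξ := fun ξ hξ => by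
    simp only [w]; rw [mul_inv_cancel_left₀ (hne ξ hξ)]
  have h0 := ae_ne_zero_Rn (d := d) (by omega)
  have hw : MemLp w 2 volume := by
    rw [memLp_two_iff_integrable_sq_norm hwm]
    -- Only integrability matters here, so any splitting radius will do; R = 1.
    refine (integrable_quotientBound hd α one_pos z).mono' (hwm.norm.pow 2) ?_
    filter_upwards [h0, hzα] with ξ hξ hα
    rw [Real.norm_of_nonneg (by positivity)]
    exact norm_sq_le_quotientBound one_pos hξ hα (hwz ξ hξ)
  have hnorm : ∀ ξ : Rn d, ‖(symb ξ : ℂ)‖ = symb ξ := fun ξ => by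
    rw [Complex.norm_real, Real.norm_of_nonneg (symb_nonneg ξ)]
  have hzn : ∀ ξ : Rn d, ξ ≠ 0 → (symb ξ + symb ξ ^ 2) * ‖w ξ‖ = ‖z ξ‖ := fun ξ hξ => by
    rw [← norm_symb_add_sq, ← norm_mul, hwz ξ hξ]
  have hw1 : MemLp (fun ξ => (-symb ξ : ℂ) * w ξ) 2 volume := by
    refine (Lp.memLp z).of_le (hsymb.neg.aestronglyMeasurable.mul hwm) ?_
    filter_upwards [h0] with ξ hξ
    rw [norm_mul, norm_neg, hnorm, ← hzn ξ hξ]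
    gcongr
    nlinarith [sq_nonneg (symb ξ)]
  have hw2 : MemLp (fun ξ => (symb ξ : ℂ) ^ 2 * w ξ) 2 volume := by
    refine (Lp.memLp z).of_le ((hsymb.pow_const 2).aestronglyMeasurable.mul hwm) ?_
    filter_upwards [h0] with ξ hξ
    rw [norm_mul, norm_pow, hnorm, ← hzn ξ hξ]
    gcongr
    linarith [symb_nonneg ξ]
  have hinv : ∀ v : CL2 d, 𝓕 (𝓕⁻ v) = v := fun v => FourierTransform.fourier_fourierInv_eq v
  -- If w is the transform of u, then -s w and s² w, both dominated by |z|, are those of Δu and Δ²u.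
  have e1 : Δ (Lp.toTemperedDistribution (𝓕⁻ (hw.toLp w))) =
      Lp.toTemperedDistribution (𝓕⁻ (hw1.toLp _)) := by
    rw [laplacian_eq_iff, hinv, hinv]
    filter_upwards [hw.coeFn_toLp, hw1.coeFn_toLp] with ξ a1 a2
    rw [a1, a2]
  have e2 : Δ (Lp.toTemperedDistribution (𝓕⁻ (hw1.toLp _))) =
      Lp.toTemperedDistribution (𝓕⁻ (hw2.toLp _)) := by
    rw [laplacian_eq_iff, hinv, hinv]
    filter_upwards [hw1.coeFn_toLp, hw2.coeFn_toLp] with ξ a1 a2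
    rw [a1, a2]; ring
  have e3 : 𝓕⁻ (hw2.toLp _) - 𝓕⁻ (hw1.toLp _) = complexify (hF.toLp F) := by
    have : hw2.toLp _ - hw1.toLp _ = z := by
      apply Lp.ext
      filter_upwards [Lp.coeFn_sub (hw2.toLp _) (hw1.toLp _), hw1.coeFn_toLp, hw2.coeFn_toLp, h0]
        with ξ a0 a1 a2 hξ
      rw [a0, Pi.sub_apply, a1, a2, ← hwz ξ hξ]; ring
    have h4 := (FourierTransform.fourierInvCLM ℂ (CL2 d)).map_sub (hw2.toLp _) (hw1.toLp _)
    simp only [FourierTransform.fourierInvCLM_apply] at h4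
    rw [← h4, this, hz]
    exact FourierTransform.fourierInv_fourier_eq _
  have r1 := laplacian_toDistr_reLp e1
  have r2 := laplacian_toDistr_reLp e2
  -- The inverse transform of w is a priori complex valued; as F is real, its real part solves the
  -- same equation.
  refine ⟨reLp (𝓕⁻ (hw.toLp w)), ⟨_, by rw [r1, r2]⟩, hF, ?_⟩
  rw [r1, r2, neg_add_eq_sub, ← toDistr_sub]
  congr 1
  have h5 := (Complex.reCLM.compLpL 2 (volume : Measure (Rn d))).map_sub
    (𝓕⁻ (hw2.toLp _)) (𝓕⁻ (hw1.toLp _))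
  refine h5.symm.trans ?_
  rw [e3]
  apply Lp.ext
  filter_upwards [coeFn_reLp (complexify (hF.toLp F)), coeFn_complexify (hF.toLp F)] with x a1 a2
  refine a1.trans ?_
  rw [a2, Complex.ofReal_re]

end Poisson

/-! ### The embedding of H⁴ into L^∞ for d ≤ 7. -/

section Sobolev

variable {d N : ℕ}

/-- The Cauchy–Schwarz inequality for integrals. -/
theorem integral_mul_le_eLpNorm_two_mul {X : Type*} [MeasurableSpace X] {μ : Measure X} {a b : X → ℝ}
    (ha : MemLp a 2 μ) (hb : MemLp b 2 μ) :
    ∫ x, a x * b x ∂μ ≤ (eLpNorm a 2 μ).toReal * (eLpNorm b 2 μ).toReal := by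
  have h := real_inner_le_norm (ha.toLp a) (hb.toLp b)
  rw [L2.inner_def, Lp.norm_toLp, Lp.norm_toLp] at h
  refine (integral_congr_ae ?_).trans_le h
  filter_upwards [ha.coeFn_toLp, hb.coeFn_toLp] with x h1 h2
  rw [h1, h2]
  simp [mul_comm]

/-- The square is at most 64 (1 + |ξ|)⁻⁸, which is integrable because d < 8. -/
theorem memLp_inv_one_add_symb_sq (hd : d ≤ 7) :
    MemLp (fun ξ : Rn d => (1 + symb ξ ^ 2)⁻¹) 2 volume := by
  have hpos : ∀ ξ : Rn d, 0 < 1 + symb ξ ^ 2 := fun ξ => by positivity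
  have hc : Continuous fun ξ : Rn d => (1 + symb ξ ^ 2)⁻¹ :=
    (continuous_const.add (continuous_symb.pow 2)).inv₀ fun ξ => (hpos ξ).ne'
  rw [memLp_two_iff_integrable_sq hc.aestronglyMeasurable]
  have hi : Integrable fun ξ : Rn d => (1 + ‖ξ‖) ^ (-(8 : ℝ)) := by
    apply integrable_one_add_norm
    rw [finrank_euclideanSpace_fin]
    exact_mod_cast (by omega : d < 8)
  refine (hi.const_mul 64).mono' (hc.pow 2).aestronglyMeasurable (.of_forall fun ξ => ?_)
  rw [Real.norm_of_nonneg (by positivity), Real.rpow_neg (by positivity),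
    show (8 : ℝ) = ((8 : ℕ) : ℝ) by norm_num, Real.rpow_natCast, inv_pow, ← div_eq_mul_inv,
    inv_le_comm₀ (by positivity) (by positivity), inv_div, div_le_iff₀ (by norm_num)]
  have h1 : (1 + ‖ξ‖) ^ 4 ≤ 8 * (1 + ‖ξ‖ ^ 4) := by
    nlinarith [sq_nonneg (‖ξ‖ - 1), sq_nonneg (‖ξ‖ ^ 2 - 1), sq_nonneg (‖ξ‖ ^ 2 - ‖ξ‖)]
  have h2 : ‖ξ‖ ^ 4 ≤ symb ξ ^ 2 := by
    have : 1 ≤ (2 * Real.pi) ^ 2 := one_le_pow₀ (by linarith [Real.pi_gt_three])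
    calc ‖ξ‖ ^ 4 = (1 * ‖ξ‖ ^ 2) ^ 2 := by ring
      _ ≤ symb ξ ^ 2 := by unfold symb; gcongr
  have h3 : (1 + ‖ξ‖) ^ 4 ≤ 8 * (1 + symb ξ ^ 2) := by linarith
  calc (1 + ‖ξ‖) ^ 8 = ((1 + ‖ξ‖) ^ 4) ^ 2 := by ring
    _ ≤ (8 * (1 + symb ξ ^ 2)) ^ 2 := by gcongr
    _ = (1 + symb ξ ^ 2) ^ 2 * 64 := by ring

/-- The Sobolev embedding `H⁴(ℝᵈ) ⊆ L^∞(ℝᵈ)` for `d ≤ 7`. -/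
theorem exists_sobolev_bound (hd : d ≤ 7) :
    ∃ c : ℝ, 0 ≤ c ∧ ∀ φ ∈ H4 d,
      eLpNorm (φ : Rn d → ℝ) ∞ volume ≤ ENNReal.ofReal (c * normH4 φ) := by
  have hk := memLp_inv_one_add_symb_sq hd
  set C := (eLpNorm (fun ξ : Rn d => (1 + symb ξ ^ 2)⁻¹) 2 volume).toReal with hC
  refine ⟨C * 2, by positivity, fun φ hφ => ?_⟩
  set z : CL2 d := 𝓕 (complexify φ) with hz
  -- Here y is the transform of φ + Δ²φ, so z = y / (1 + s²). By Cauchy–Schwarz z is integrable, and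
  -- the factor 2 in the constant comes from ‖φ‖ + ‖Δ²φ‖ ≤ 2‖φ‖_{H⁴}.
  set y : CL2 d := z + 𝓕 (complexify (bilaplacian φ)) with hy
  have hbi := (bilaplacian_eq_iff _ _).1 (bilaplacian_spec hφ)
  have hyn : ‖y‖ ≤ 2 * normH4 φ := by
    have h1 : ‖z‖ = ‖φ‖ := by rw [hz, Lp.norm_fourier_eq, norm_complexify]
    have h2 : ‖(𝓕 (complexify (bilaplacian φ)) : CL2 d)‖ = ‖bilaplacian φ‖ := by
      rw [Lp.norm_fourier_eq, norm_complexify]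
    have := norm_add_le z (𝓕 (complexify (bilaplacian φ)))
    linarith [norm_le_normH4 φ, norm_bilaplacian_le_normH4 φ]
  have hzy : ∀ᵐ ξ, ‖z ξ‖ = (1 + symb ξ ^ 2)⁻¹ * ‖y ξ‖ := by
    filter_upwards [hbi, Lp.coeFn_add z (𝓕 (complexify (bilaplacian φ)))] with ξ h1 h2
    have h3 : y ξ = ((1 + symb ξ ^ 2 : ℝ) : ℂ) * z ξ := by
      rw [hy, h2, Pi.add_apply, ← h1]; push_cast; ring
    have h4 : 0 < 1 + symb ξ ^ 2 := by positivity
    rw [h3, norm_mul, Complex.norm_real, Real.norm_of_nonneg h4.le, inv_mul_cancel_left₀ h4.ne']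
  have hyL : MemLp (fun ξ => ‖y ξ‖) 2 volume := (Lp.memLp y).norm
  have hint : Integrable z := by
    rw [← integrable_norm_iff (Lp.aestronglyMeasurable z)]
    exact (hk.integrable_mul hyL).congr (hzy.mono fun ξ h => h.symm)
  have hbound : ∫ ξ, ‖z ξ‖ ≤ C * 2 * normH4 φ := by
    rw [integral_congr_ae hzy]
    refine (integral_mul_le_eLpNorm_two_mul hk hyL).trans ?_
    rw [eLpNorm_norm, ← Lp.norm_def, mul_assoc]
    gcongr
  rw [eLpNorm_exponent_top]
  refine eLpNormEssSup_le_of_ae_bound ?_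
  filter_upwards [norm_le_of_integrable_fourier _ hint, coeFn_complexify φ] with x h1 h2
  rw [h2, Complex.norm_real] at h1
  exact h1.trans hbound

theorem normH4_nonneg (φ : L2 d) : 0 ≤ normH4 φ := Real.sqrt_nonneg _

theorem normH4Vec_nonneg (u : Fin N → L2 d) : 0 ≤ normH4Vec u := Real.sqrt_nonneg _

theorem normH4Vec_sq (u : Fin N → L2 d) : normH4Vec u ^ 2 = ∑ m, normH4 (u m) ^ 2 :=
  Real.sq_sqrt (Finset.sum_nonneg fun _ _ => sq_nonneg _)

theorem sobolevConst_nonneg : 0 ≤ sobolevConst d := Real.sInf_nonneg fun _ h => h.1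

/-- The optimal Sobolev constant is a Sobolev constant. -/
theorem ae_abs_le_sobolevConst_mul (hd : d ≤ 7) {φ : L2 d} (hφ : φ ∈ H4 d) :
    ∀ᵐ x, |φ x| ≤ sobolevConst d * normH4 φ := by
  set S := {c : ℝ | 0 ≤ c ∧ ∀ φ ∈ H4 d,
    eLpNorm (φ : Rn d → ℝ) ∞ volume ≤ ENNReal.ofReal (c * normH4 φ)} with hS
  -- For each fixed φ the inequality is a closed condition on c, so it passes from S to its infimum.
  have hmem : sInf S ∈ closure S := csInf_mem_closure (exists_sobolev_bound hd) ⟨0, fun _ h => h.1⟩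
  have hcl : IsClosed {c : ℝ | eLpNorm (φ : Rn d → ℝ) ∞ volume ≤ ENNReal.ofReal (c * normH4 φ)} :=
    isClosed_le continuous_const (ENNReal.continuous_ofReal.comp (continuous_id.mul continuous_const))
  have h : eLpNorm (φ : Rn d → ℝ) ∞ volume ≤ ENNReal.ofReal (sobolevConst d * normH4 φ) :=
    closure_minimal (fun c (hc : c ∈ S) => hc.2 φ hφ) hcl hmem
  rw [eLpNorm_exponent_top] at h
  filter_upwards [enorm_ae_le_eLpNormEssSup (φ : Rn d → ℝ) volume] with x hx
  have h2 := hx.trans h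
  rw [← ofReal_norm, ENNReal.ofReal_le_ofReal_iff
    (mul_nonneg sobolevConst_nonneg (normH4_nonneg φ))] at h2
  exact h2

theorem norm_evalVec_sq (u : Fin N → L2 d) (x : Rn d) : ‖evalVec u x‖ ^ 2 = ∑ m, (u m x) ^ 2 := by
  rw [EuclideanSpace.norm_sq_eq]
  simp [evalVec]

/-- The scalar embedding is applied to each component and the squares are added, so the scalar
constant serves for vectors without a factor depending on N. -/
theorem ae_norm_evalVec_le (hd : d ≤ 7) {ce : ℝ} (hce : sobolevConst d ≤ ce) {u : Fin N → L2 d}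
    (hu : u ∈ H4Vec d N) : ∀ᵐ x, ‖evalVec u x‖ ≤ ce * normH4Vec u := by
  have hce0 : 0 ≤ ce := sobolevConst_nonneg.trans hce
  have h : ∀ᵐ x, ∀ m, |u m x| ≤ sobolevConst d * normH4 (u m) :=
    ae_all_iff.2 fun m => ae_abs_le_sobolevConst_mul hd (hu m)
  filter_upwards [h] with x hx
  refine le_of_sq_le_sq ?_ (mul_nonneg hce0 (normH4Vec_nonneg u))
  rw [norm_evalVec_sq, mul_pow, normH4Vec_sq, Finset.mul_sum]
  refine Finset.sum_le_sum fun m _ => ?_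
  rw [← sq_abs, ← mul_pow]
  exact pow_le_pow_left₀ (abs_nonneg _)
    ((hx m).trans (mul_le_mul_of_nonneg_right hce (normH4_nonneg _))) 2

end Sobolev

/-! ### Convolutions and Young's inequality. -/

section Convolution

variable {d : ℕ}

/-- The convolution `x ↦ ∫ H(x - y) G(y) dy`. -/
def conv (H G : Rn d → ℝ) (x : Rn d) : ℝ := ∫ y, H (x - y) * G y

theorem eLpNorm_two_toReal_sq {X : Type*} [MeasurableSpace X] {μ : Measure X} {a : X → ℝ}
    (ha : MemLp a 2 μ) : (eLpNorm a 2 μ).toReal ^ 2 = ∫ x, a x ^ 2 ∂μ := by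
  have h := L2.inner_def (𝕜 := ℝ) (ha.toLp a) (ha.toLp a)
  rw [real_inner_self_eq_norm_sq, Lp.norm_toLp] at h
  rw [h]
  refine integral_congr_ae ?_
  filter_upwards [ha.coeFn_toLp] with x h1
  rw [h1]
  simp [pow_two]

theorem conv_comm (H G : Rn d → ℝ) : conv H G = conv G H := by
  ext x
  unfold conv
  rw [← integral_sub_left_eq_self _ volume x]
  simp [mul_comm]

theorem conv_eq_convolution (H G : Rn d → ℝ) :
    conv H G = convolution G H (ContinuousLinearMap.mul ℝ ℝ) volume := by
  ext x
  simp [conv, convolution, mul_comm]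

theorem integrable_conv {H G : Rn d → ℝ} (hH : Integrable H volume) (hG : Integrable G volume) :
    Integrable (conv H G) volume := by
  rw [conv_eq_convolution]
  exact hG.integrable_convolution _ hH

theorem integral_conv {H G : Rn d → ℝ} (hH : Integrable H volume) (hG : Integrable G volume) :
    ∫ x, conv H G x = (∫ x, H x) * ∫ x, G x := by
  rw [conv_eq_convolution, integral_convolution _ hG hH]
  simp [mul_comm]

theorem aestronglyMeasurable_comp_sub_left {H : Rn d → ℝ} (hH : AEStronglyMeasurable H volume)
    (x : Rn d) : AEStronglyMeasurable (fun y => H (x - y)) volume :=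
  hH.comp_quasiMeasurePreserving (quasiMeasurePreserving_sub_left volume x)

theorem memLp_comp_sub_left {H : Rn d → ℝ} {p : ℝ≥0∞} (hH : MemLp H p volume)
    (x : Rn d) : MemLp (fun y => H (x - y)) p volume :=
  hH.comp_measurePreserving (Measure.measurePreserving_sub_left volume x)

/-- Young's inequality `L¹ * L¹ → L¹`. -/
theorem integral_abs_conv_le {H G : Rn d → ℝ} (hH : Integrable H volume)
    (hG : Integrable G volume) :
    ∫ x, |conv H G x| ≤ (∫ x, |H x|) * ∫ x, |G x| := by
  rw [← integral_conv hH.abs hG.abs]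
  refine integral_mono (integrable_conv hH hG).abs (integrable_conv hH.abs hG.abs) fun x => ?_
  refine (abs_integral_le_integral_abs).trans_eq ?_
  simp [conv, abs_mul]

/-- Cauchy–Schwarz for the factorization |H||G| = (|H|√|G|) · √|G|. It is applied at those x where
the convolution of H² with |G| converges, that is, almost everywhere. -/
theorem ae_conv_sq_le {H G : Rn d → ℝ} (hH2 : MemLp H 2 volume) (hG : Integrable G volume) :
    ∀ᵐ x, conv H G x ^ 2 ≤ conv (fun z => H z ^ 2) (fun y => |G y|) x * ∫ y, |G y| := by
  have hsq : Integrable (fun z => H z ^ 2) volume := hH2.integrable_sq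
  have hex := hG.abs.ae_convolution_exists (ContinuousLinearMap.mul ℝ ℝ) hsq
  filter_upwards [hex] with x hx
  have hx' : Integrable (fun y => H (x - y) ^ 2 * |G y|) volume := by
    simpa [ConvolutionExistsAt, mul_comm] using hx
  have hsm : AEStronglyMeasurable (fun y => √|G y|) volume :=
    Real.continuous_sqrt.comp_aestronglyMeasurable hG.abs.aestronglyMeasurable
  have hb : MemLp (fun y => √|G y|) 2 volume := by
    rw [memLp_two_iff_integrable_sq hsm]
    simpa [Real.sq_sqrt] using hG.abs
  have ha : MemLp (fun y => |H (x - y)| * √|G y|) 2 volume := by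
    refine (memLp_two_iff_integrable_sq
      ((aestronglyMeasurable_comp_sub_left hH2.1 x).norm.mul hsm)).2 ?_
    simpa [Real.sq_sqrt, mul_pow] using hx'
  have h1 : |conv H G x| ≤ ∫ y, (|H (x - y)| * √|G y|) * √|G y| := by
    refine (abs_integral_le_integral_abs).trans_eq (integral_congr_ae (.of_forall fun y => ?_))
    simp only [abs_mul, mul_assoc, Real.mul_self_sqrt (abs_nonneg (G y))]
  have h2 := h1.trans (integral_mul_le_eLpNorm_two_mul ha hb)
  calc conv H G x ^ 2 = |conv H G x| ^ 2 := (sq_abs _).symm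
    _ ≤ _ := pow_le_pow_left₀ (abs_nonneg _) h2 2
    _ = _ := by
      rw [mul_pow, eLpNorm_two_toReal_sq ha, eLpNorm_two_toReal_sq hb]
      simp [conv, Real.sq_sqrt, mul_pow]

theorem memLp_two_conv {H G : Rn d → ℝ} (hH : Integrable H volume) (hH2 : MemLp H 2 volume)
    (hG : Integrable G volume) : MemLp (conv H G) 2 volume := by
  have hm := (integrable_conv hH hG).aestronglyMeasurable
  rw [memLp_two_iff_integrable_sq hm]
  refine ((integrable_conv hH2.integrable_sq hG.abs).mul_const (∫ y, |G y|)).mono' (hm.pow 2) ?_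
  filter_upwards [ae_conv_sq_le hH2 hG] with x hx
  rwa [Real.norm_of_nonneg (sq_nonneg _)]

/-- Young's inequality `L² * L¹ → L²`. -/
theorem eLpNorm_two_conv_le {H G : Rn d → ℝ} (hH : Integrable H volume) (hH2 : MemLp H 2 volume)
    (hG : Integrable G volume) :
    (eLpNorm (conv H G) 2 volume).toReal ≤ (eLpNorm H 2 volume).toReal * ∫ x, |G x| := by
  have hm := memLp_two_conv hH hH2 hG
  have hG0 : 0 ≤ ∫ x, |G x| := integral_nonneg fun _ => abs_nonneg _
  refine le_of_sq_le_sq ?_ (by positivity)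
  rw [eLpNorm_two_toReal_sq hm, mul_pow, eLpNorm_two_toReal_sq hH2]
  calc ∫ x, conv H G x ^ 2
      ≤ ∫ x, conv (fun z => H z ^ 2) (fun y => |G y|) x * ∫ y, |G y| :=
        integral_mono_ae hm.integrable_sq
          ((integrable_conv hH2.integrable_sq hG.abs).mul_const _) (ae_conv_sq_le hH2 hG)
    _ = _ := by rw [integral_mul_const, integral_conv hH2.integrable_sq hG.abs]; ring

theorem conv_sub {H G G' : Rn d → ℝ} (hH : MemLp H 2 volume) (hG : MemLp G 2 volume)
    (hG' : MemLp G' 2 volume) : conv H (G - G') = conv H G - conv H G' := by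
  ext x
  have hx := memLp_comp_sub_left hH x
  simp only [conv, Pi.sub_apply, mul_sub]
  exact integral_sub (hx.integrable_mul hG) (hx.integrable_mul hG')

theorem conv_congr {H G G' : Rn d → ℝ} (h : G =ᵐ[volume] G') : conv H G = conv H G' := by
  ext x
  refine integral_congr_ae ?_
  filter_upwards [h] with y hy
  rw [hy]

theorem production_eq_mul_conv {N : ℕ} (ε : ℝ) (H : Rn d → ℝ) (g : Rn N → ℝ) (w : Rn d → Rn N) :
    production ε H g w = fun x => ε * conv H (g ∘ w) x := rfl

end Convolution

/-! ### Lipschitz and quadratic bounds from the C² norm on a ball. -/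

section Nonlinearity

variable {N : ℕ}

theorem normC_nonneg (I : Set (Rn N)) (h : Rn N → ℝ) : 0 ≤ normC I h := by
  refine Real.sSup_nonneg ?_
  rintro _ ⟨z, -, rfl⟩
  exact abs_nonneg _

theorem abs_le_normC {I : Set (Rn N)} (hI : IsCompact I) {h : Rn N → ℝ} (hh : ContinuousOn h I)
    {z : Rn N} (hz : z ∈ I) : |h z| ≤ normC I h :=
  le_csSup (hI.image_of_continuousOn hh.abs).bddAbove ⟨z, hz, rfl⟩

theorem normC2_nonneg (I : Set (Rn N)) (h : Rn N → ℝ) : 0 ≤ normC2 I h :=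
  add_nonneg (add_nonneg (normC_nonneg _ _) (Finset.sum_nonneg fun _ _ => normC_nonneg _ _))
    (Finset.sum_nonneg fun _ _ => Finset.sum_nonneg fun _ _ => normC_nonneg _ _)

theorem normC2_le_normC2Vec (I : Set (Rn N)) (g : Fin N → Rn N → ℝ) (m : Fin N) :
    normC2 I (g m) ≤ normC2Vec I g :=
  Finset.single_le_sum (f := fun m => normC2 I (g m)) (fun _ _ => normC2_nonneg _ _)
    (Finset.mem_univ m)

theorem normC2Vec_nonneg (I : Set (Rn N)) (g : Fin N → Rn N → ℝ) : 0 ≤ normC2Vec I g :=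
  Finset.sum_nonneg fun _ _ => normC2_nonneg _ _

/-- Each coordinate of v is at most ‖v‖, so a sum of bounds on partial derivatives, as it occurs in
the C² norm, dominates the operator norm. -/
theorem abs_apply_le_sum_mul_norm (L : Rn N →L[ℝ] ℝ) (v : Rn N) {c : Fin N → ℝ}
    (hc : ∀ n, |L (EuclideanSpace.single n 1)| ≤ c n) : |L v| ≤ (∑ n, c n) * ‖v‖ := by
  have hv : v = ∑ n, v n • EuclideanSpace.single n (1 : ℝ) := by
    ext i
    simp [Finset.sum_apply, Pi.single_apply]
  conv_lhs => rw [hv]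
  rw [map_sum, Finset.sum_mul]
  refine (Finset.abs_sum_le_sum_abs _ _).trans (Finset.sum_le_sum fun n _ => ?_)
  rw [map_smul, smul_eq_mul, abs_mul, mul_comm]
  have h1 : |v n| ≤ ‖v‖ := PiLp.norm_apply_le v n
  exact mul_le_mul (hc n) h1 (abs_nonneg _) ((abs_nonneg _).trans (hc n))

variable {r : ℝ} {h : Rn N → ℝ}

theorem uniqueDiffOn_closedBall_zero (hr : 0 < r) :
    UniqueDiffOn ℝ (Metric.closedBall (0 : Rn N) r) :=
  uniqueDiffOn_convex (convex_closedBall _ _)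
    ⟨0, Metric.ball_subset_interior_closedBall (Metric.mem_ball_self hr)⟩

theorem ContDiffOn.partialOn {I : Set (Rn N)} (hI : UniqueDiffOn ℝ I) {k l : ℕ∞}
    (hh : ContDiffOn ℝ k h I) (hkl : l + 1 ≤ k) (n : Fin N) : ContDiffOn ℝ l (partialOn I n h) I :=
  (hh.fderivWithin hI (by exact_mod_cast hkl)).clm_apply contDiffOn_const

/-- Functions in `C²(I)` are Lipschitz on the ball `I`. -/
theorem abs_sub_le_normC2_mul (hr : 0 < r) (hh : ContDiffOn ℝ 2 h (Metric.closedBall 0 r))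
    {z z' : Rn N} (hz : z ∈ Metric.closedBall (0 : Rn N) r)
    (hz' : z' ∈ Metric.closedBall (0 : Rn N) r) :
    |h z - h z'| ≤ normC2 (Metric.closedBall 0 r) h * ‖z - z'‖ := by
  set I := Metric.closedBall (0 : Rn N) r with hI
  have hIc : IsCompact I := isCompact_closedBall 0 r
  have hu := uniqueDiffOn_closedBall_zero (N := N) hr
  have hcont : ∀ n, ContinuousOn (partialOn I n h) I := fun n =>
    (hh.partialOn (k := 2) (l := 1) hu (by norm_num) n).continuousOn
  have hbound : ∀ x ∈ I, ‖fderivWithin ℝ h I x‖ ≤ normC2 I h := by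
    intro x hx
    refine ContinuousLinearMap.opNorm_le_bound _ (normC2_nonneg _ _) fun v => ?_
    have h1 := abs_apply_le_sum_mul_norm (fderivWithin ℝ h I x) v
      (c := fun n => normC I (partialOn I n h)) fun n => abs_le_normC hIc (hcont n) hx
    refine h1.trans (mul_le_mul_of_nonneg_right ?_ (norm_nonneg _))
    unfold normC2
    have := normC_nonneg I h
    have : 0 ≤ ∑ n, ∑ l, normC I (partialOn I n (partialOn I l h)) :=
      Finset.sum_nonneg fun _ _ => Finset.sum_nonneg fun _ _ => normC_nonneg _ _
    linarith
  exact (convex_closedBall 0 r).norm_image_sub_le_of_norm_fderivWithin_le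
    (hh.differentiableOn (by norm_num)) hbound hz' hz

/-- Every first partial derivative vanishes at the origin and has gradient controlled by the second
derivatives, so the mean value inequality between 0 and z makes it O(‖z‖). -/
theorem abs_fderivWithin_apply_le (hr : 0 < r) (hh : ContDiffOn ℝ 2 h (Metric.closedBall 0 r))
    (h0 : fderiv ℝ h 0 = 0) {z : Rn N} (hz : z ∈ Metric.closedBall (0 : Rn N) r) (v : Rn N) :
    |fderivWithin ℝ h (Metric.closedBall 0 r) z v| ≤
      normC2 (Metric.closedBall 0 r) h * ‖z‖ * ‖v‖ := by
  set I := Metric.closedBall (0 : Rn N) r with hI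
  have hIc : IsCompact I := isCompact_closedBall 0 r
  have hu := uniqueDiffOn_closedBall_zero (N := N) hr
  have hI0 : I ∈ nhds (0 : Rn N) := Metric.closedBall_mem_nhds 0 hr
  have h1 : ∀ l, ContDiffOn ℝ 1 (partialOn I l h) I := fun l =>
    hh.partialOn (k := 2) (l := 1) hu (by norm_num) l
  have h2 : ∀ n l, ContinuousOn (partialOn I n (partialOn I l h)) I := fun n l =>
    ((h1 l).partialOn (k := 1) (l := 0) hu (by norm_num) n).continuousOn
  have hl : ∀ l, |partialOn I l h z| ≤ (∑ n, normC I (partialOn I n (partialOn I l h))) * ‖z‖ := by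
    intro l
    have hzero : partialOn I l h 0 = 0 := by
      rw [partialOn, fderivWithin_of_mem_nhds hI0, h0]; rfl
    have hbound : ∀ x ∈ I, ‖fderivWithin ℝ (partialOn I l h) I x‖ ≤
        ∑ n, normC I (partialOn I n (partialOn I l h)) := by
      intro x hx
      refine ContinuousLinearMap.opNorm_le_bound _
        (Finset.sum_nonneg fun _ _ => normC_nonneg _ _) fun v => ?_
      exact abs_apply_le_sum_mul_norm (fderivWithin ℝ (partialOn I l h) I x) v
        fun n => abs_le_normC hIc (h2 n l) hx
    have := (convex_closedBall 0 r).norm_image_sub_le_of_norm_fderivWithin_le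
      ((h1 l).differentiableOn (by norm_num)) hbound (mem_of_mem_nhds hI0) hz
    rwa [hzero, sub_zero, sub_zero] at this
  refine (abs_apply_le_sum_mul_norm (fderivWithin ℝ h I z) v hl).trans ?_
  refine mul_le_mul_of_nonneg_right ?_ (norm_nonneg _)
  rw [← Finset.sum_mul]
  refine mul_le_mul_of_nonneg_right ?_ (norm_nonneg _)
  unfold normC2
  rw [Finset.sum_comm]
  have := normC_nonneg I h
  have : 0 ≤ ∑ n, normC I (partialOn I n h) := Finset.sum_nonneg fun _ _ => normC_nonneg _ _
  linarith

/-- Functions in `C²(I)` with vanishing gradient at the origin have quadratic increments. -/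
theorem abs_sub_le_normC2_mul_add_norm (hr : 0 < r)
    (hh : ContDiffOn ℝ 2 h (Metric.closedBall 0 r)) (h0 : fderiv ℝ h 0 = 0)
    {z z' : Rn N} (hz : z ∈ Metric.closedBall (0 : Rn N) r)
    (hz' : z' ∈ Metric.closedBall (0 : Rn N) r) :
    |h z - h z'| ≤ normC2 (Metric.closedBall 0 r) h * ((‖z‖ + ‖z'‖) / 2 * ‖z - z'‖) := by
  set I := Metric.closedBall (0 : Rn N) r with hI
  set B := normC2 I h with hB
  have hB0 : 0 ≤ B := normC2_nonneg _ _
  have hmem : ∀ t ∈ Set.Icc (0 : ℝ) 1, z' + t • (z - z') ∈ I := by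
    intro t ht
    have := (convex_closedBall (0 : Rn N) r) hz' hz (sub_nonneg.2 ht.2) ht.1 (by ring)
    convert this using 1
    module
  have hderiv : ∀ t ∈ Set.Icc (0 : ℝ) 1, HasDerivWithinAt (fun t : ℝ => h (z' + t • (z - z')) - h z')
      (fderivWithin ℝ h I (z' + t • (z - z')) (z - z')) (Set.Icc 0 1) t := by
    intro t ht
    have hd := (hh.differentiableOn (by norm_num) _ (hmem t ht)).hasFDerivWithinAt
    have hline : HasDerivWithinAt (fun t : ℝ => z' + t • (z - z')) (z - z') (Set.Icc 0 1) t := by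
      simpa using (((hasDerivWithinAt_id t _).smul_const (z - z')).const_add z')
    exact (hd.comp_hasDerivWithinAt t hline hmem).sub_const _
  -- The comparison function is the integral over [0, t] of the bound B‖z - z'‖(‖z'‖ + (‖z‖ -
  -- ‖z'‖)τ) for the derivative along the segment from z' to z. At t = 1 it produces the mean (‖z‖ +
  -- ‖z'‖)/2.
  have hbd : ∀ t, HasDerivAt
      (fun t : ℝ => B * ‖z - z'‖ * (‖z'‖ * t + (‖z‖ - ‖z'‖) * (t ^ 2 / 2)))
      (B * ‖z - z'‖ * (‖z'‖ + (‖z‖ - ‖z'‖) * t)) t := by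
    intro t
    have h1 := ((hasDerivAt_id t).const_mul ‖z'‖).add
      (((hasDerivAt_pow 2 t).div_const 2).const_mul (‖z‖ - ‖z'‖))
    refine (h1.const_mul (B * ‖z - z'‖)).congr_deriv ?_
    push_cast
    ring
  have key := image_norm_le_of_norm_deriv_right_le_deriv_boundary
    (f := fun t : ℝ => h (z' + t • (z - z')) - h z') (a := 0) (b := 1)
    (fun t ht => (hderiv t ht).continuousWithinAt)
    (fun t ht => ((hderiv t (Set.Ico_subset_Icc_self ht)).mono_of_mem_nhdsWithin
      (Icc_mem_nhdsGE_of_mem ht))) (by simp) hbd (fun t ht => by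
      have hn : ‖z' + t • (z - z')‖ ≤ ‖z'‖ + (‖z‖ - ‖z'‖) * t := by
        have e : z' + t • (z - z') = (1 - t) • z' + t • z := by module
        rw [e]
        refine (norm_add_le _ _).trans ?_
        rw [norm_smul, norm_smul, Real.norm_of_nonneg ht.1, Real.norm_of_nonneg (by linarith [ht.2])]
        linarith
      refine (abs_fderivWithin_apply_le hr hh h0 (hmem t (Set.Ico_subset_Icc_self ht)) _).trans ?_
      calc B * ‖z' + t • (z - z')‖ * ‖z - z'‖
          ≤ B * (‖z'‖ + (‖z‖ - ‖z'‖) * t) * ‖z - z'‖ := by gcongr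
        _ = _ := by ring)
    (Set.right_mem_Icc.2 zero_le_one)
  simp only [one_smul, add_sub_cancel, Real.norm_eq_abs] at key
  refine key.trans_eq ?_
  ring

end Nonlinearity

/-! ### Completeness of the balls of H⁴ via the graph of Δ², and the contraction principle. -/

section GraphEmbedding

variable {d N : ℕ}

theorem bilaplacian_toDistr_zero : Δ (Δ (toDistr (0 : L2 d))) = toDistr (0 : L2 d) := by
  have h : Δ (0 : 𝓢'(Rn d, ℂ)) = 0 := by simpa using laplacian_sub (0 : 𝓢'(Rn d, ℂ)) 0
  rw [toDistr_zero, h, h]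

theorem zero_mem_H4 : (0 : L2 d) ∈ H4 d := ⟨0, bilaplacian_toDistr_zero⟩

theorem zero_mem_H4Vec : (0 : Fin N → L2 d) ∈ H4Vec d N := fun _ => zero_mem_H4

theorem bilaplacian_zero : bilaplacian (0 : L2 d) = 0 := bilaplacian_eq bilaplacian_toDistr_zero

theorem H4Vec_add {u v : Fin N → L2 d} (hu : u ∈ H4Vec d N) (hv : v ∈ H4Vec d N) :
    u + v ∈ H4Vec d N := fun m =>
  ⟨_, bilaplacian_toDistr_add (bilaplacian_spec (hu m)) (bilaplacian_spec (hv m))⟩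

/-- The pairs `(u, Δ²u)`, whose Hilbert norm is the norm of `H⁴(ℝᵈ, ℝᴺ)`. -/
def graphEmbedding (u : Fin N → L2 d) : PiLp 2 fun _ : Fin N => WithLp 2 (L2 d × L2 d) :=
  WithLp.toLp 2 fun m => WithLp.toLp 2 (u m, bilaplacian (u m))

theorem norm_graphEmbedding (u : Fin N → L2 d) : ‖graphEmbedding u‖ = normH4Vec u := by
  rw [PiLp.norm_eq_of_L2, normH4Vec]
  congr 1
  refine Finset.sum_congr rfl fun m _ => ?_
  rw [WithLp.prod_norm_sq_eq_of_L2, normH4_sq]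
  rfl

/-- Membership is essential: `bilaplacian` has the default value 0 off H⁴, where additivity can
fail. -/
theorem graphEmbedding_add {u v : Fin N → L2 d} (hu : u ∈ H4Vec d N) (hv : v ∈ H4Vec d N) :
    graphEmbedding (u + v) = graphEmbedding u + graphEmbedding v := by
  have h : ∀ m, bilaplacian (u m + v m) = bilaplacian (u m) + bilaplacian (v m) := fun m =>
    bilaplacian_eq (bilaplacian_toDistr_add (bilaplacian_spec (hu m)) (bilaplacian_spec (hv m)))
  simp only [graphEmbedding, Pi.add_apply, h]
  rfl

theorem graphEmbedding_sub {u v : Fin N → L2 d} (hu : u ∈ H4Vec d N) (hv : v ∈ H4Vec d N) :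
    graphEmbedding (u - v) = graphEmbedding u - graphEmbedding v := by
  have h : ∀ m, bilaplacian (u m - v m) = bilaplacian (u m) - bilaplacian (v m) := fun m =>
    bilaplacian_eq (bilaplacian_toDistr_sub (bilaplacian_spec (hu m)) (bilaplacian_spec (hv m)))
  simp only [graphEmbedding, Pi.sub_apply, h]
  rfl

theorem graphEmbedding_injective : Function.Injective (graphEmbedding (d := d) (N := N)) := by
  intro u v h
  funext m
  exact congrArg (fun p : PiLp 2 fun _ : Fin N => WithLp 2 (L2 d × L2 d) => (p m).fst) h

theorem dist_graphEmbedding {u v : Fin N → L2 d} (hu : u ∈ H4Vec d N) (hv : v ∈ H4Vec d N) :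
    dist (graphEmbedding u) (graphEmbedding v) = normH4Vec (u - v) := by
  rw [dist_eq_norm, ← graphEmbedding_sub hu hv, norm_graphEmbedding]

theorem normH4Vec_add_le {u v : Fin N → L2 d} (hu : u ∈ H4Vec d N) (hv : v ∈ H4Vec d N) :
    normH4Vec (u + v) ≤ normH4Vec u + normH4Vec v := by
  simp only [← norm_graphEmbedding, graphEmbedding_add hu hv]
  exact norm_add_le _ _

theorem normH4Vec_sub_le {u v w : Fin N → L2 d} (hu : u ∈ H4Vec d N) (hv : v ∈ H4Vec d N)
    (hw : w ∈ H4Vec d N) : normH4Vec (u - w) ≤ normH4Vec (u - v) + normH4Vec (v - w) := by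
  rw [← dist_graphEmbedding hu hw, ← dist_graphEmbedding hu hv, ← dist_graphEmbedding hv hw]
  exact dist_triangle _ _ _

theorem normH4Vec_zero : normH4Vec (0 : Fin N → L2 d) = 0 := by
  simp [normH4Vec, normH4, bilaplacian_zero]

/-- The image consists of the pairs (φ, ψ) with Δ²φ = ψ as distributions and norm at most ρ. Both
conditions are closed, since Δ and the inclusion of L² into the tempered distributions are
continuous. -/
theorem isClosed_graphEmbedding_image_ballH4 (ρ : ℝ) :
    IsClosed (graphEmbedding '' ballH4 d N ρ) := by
  have h : graphEmbedding '' ballH4 d N ρ =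
      {p : PiLp 2 fun _ : Fin N => WithLp 2 (L2 d × L2 d) | ∀ m,
        Δ (Δ (toDistr (p m).fst)) = toDistr (p m).snd} ∩ {p | ‖p‖ ≤ ρ} := by
    ext p
    constructor
    · rintro ⟨u, hu, rfl⟩
      exact ⟨fun m => bilaplacian_spec (hu.1 m), (norm_graphEmbedding u).trans_le hu.2⟩
    · rintro ⟨h1, h2⟩
      have hp : graphEmbedding (fun m => (p m).fst) = p := by
        ext m : 1
        simp only [graphEmbedding, bilaplacian_eq (h1 m)]
        rfl
      refine ⟨fun m => (p m).fst, ⟨fun m => ⟨_, h1 m⟩, ?_⟩, hp⟩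
      rwa [← norm_graphEmbedding, hp]
  rw [h]
  refine IsClosed.inter ?_ (isClosed_le continuous_norm continuous_const)
  have hset : {p : PiLp 2 fun _ : Fin N => WithLp 2 (L2 d × L2 d) | ∀ m,
        Δ (Δ (toDistr (p m).fst)) = toDistr (p m).snd} = ⋂ m, {p |
        Δ (Δ (toDistr (p m).fst)) = toDistr (p m).snd} := by
    ext p; simp
  rw [hset]
  refine isClosed_iInter fun m => ?_
  have hΔ : Continuous fun T : 𝓢'(Rn d, ℂ) => Δ T :=
    (LineDeriv.laplacianCLM ℂ (Rn d) 𝓢'(Rn d, ℂ)).continuous.congr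
      TemperedDistribution.laplacianCLM_apply
  have hm : Continuous fun p : PiLp 2 fun _ : Fin N => WithLp 2 (L2 d × L2 d) => p m :=
    PiLp.continuous_apply _ _ m
  have h1 := (WithLp.prod_continuous_ofLp 2 (L2 d) (L2 d)).comp hm
  exact isClosed_eq (hΔ.comp (hΔ.comp (continuous_toDistr.comp (continuous_fst.comp h1))))
    (continuous_toDistr.comp (continuous_snd.comp h1))

/-- The contraction principle for a map which becomes a contraction after an embedding with closed
range in a complete metric space. -/
theorem exists_forall_fixed_iff_of_isClosed_range {X E : Type*} [Nonempty X] [MetricSpace E]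
    [CompleteSpace E] {J : X → E} (hJ : Function.Injective J) (hcl : IsClosed (Set.range J))
    {T : X → X} {q : ℝ} (hq0 : 0 ≤ q) (hq1 : q < 1)
    (hT : ∀ v w, dist (J (T v)) (J (T w)) ≤ q * dist (J v) (J w)) :
    ∃ a, ∀ v, T v = v ↔ v = a := by
  -- Pulling the metric back along J makes J an isometry onto a closed, hence complete, set.
  let _ : MetricSpace X := MetricSpace.induced J hJ inferInstance
  have hiso : Isometry J := Isometry.of_dist_eq fun _ _ => rfl
  have : CompleteSpace X := hiso.isUniformInducing.completeSpace hcl.isComplete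
  have hc : ContractingWith ⟨q, hq0⟩ T :=
    ⟨by exact_mod_cast hq1, LipschitzWith.of_dist_le_mul fun v w => hT v w⟩
  refine ⟨hc.fixedPoint T, fun v => ⟨fun h => hc.fixedPoint_unique h, ?_⟩⟩
  rintro rfl
  exact hc.fixedPoint_isFixedPt

theorem exists_forall_fixed_iff_ballH4 {ρ : ℝ} (hρ : 0 ≤ ρ) {T : ballH4 d N ρ → ballH4 d N ρ}
    {q : ℝ} (hq0 : 0 ≤ q) (hq1 : q < 1) (hT : ∀ v w : ballH4 d N ρ,
      normH4Vec ((T v).1 - (T w).1) ≤ q * normH4Vec (v.1 - w.1)) :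
    ∃ a, ∀ v, T v = v ↔ v = a := by
  have : Nonempty (ballH4 d N ρ) := ⟨⟨0, zero_mem_H4Vec, normH4Vec_zero.trans_le hρ⟩⟩
  refine exists_forall_fixed_iff_of_isClosed_range (J := fun v : ballH4 d N ρ => graphEmbedding v.1)
    (graphEmbedding_injective.comp Subtype.val_injective) ?_ hq0 hq1 fun v w => ?_
  · have := isClosed_graphEmbedding_image_ballH4 (d := d) (N := N) ρ
    rwa [← Subtype.range_val (s := ballH4 d N ρ), ← Set.range_comp] at this
  · rw [dist_graphEmbedding (T v).2.1 (T w).2.1, dist_graphEmbedding v.2.1 w.2.1]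
    exact hT v w

end GraphEmbedding

/-! ### Estimates for convolution sources and the optimal frequency splitting. -/

section Estimates

variable {d N : ℕ}

theorem measurable_evalVec (w : Fin N → L2 d) : Measurable (evalVec w) :=
  (WithLp.measurable_toLp 2 _).comp
    (measurable_pi_iff.2 fun m => (Lp.stronglyMeasurable (w m)).measurable)

theorem memLp_norm_evalVec (w : Fin N → L2 d) :
    MemLp (fun x => ‖evalVec w x‖) 2 volume := by
  rw [memLp_two_iff_integrable_sq (measurable_evalVec w).norm.aestronglyMeasurable]
  simp only [norm_evalVec_sq]
  exact integrable_finsetSum _ fun m _ => (Lp.memLp (w m)).integrable_sq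

theorem eLpNorm_norm_evalVec_le (w : Fin N → L2 d) :
    (eLpNorm (fun x => ‖evalVec w x‖) 2 volume).toReal ≤ normH4Vec w := by
  refine le_of_sq_le_sq ?_ (normH4Vec_nonneg w)
  rw [eLpNorm_two_toReal_sq (memLp_norm_evalVec w), normH4Vec_sq]
  simp only [norm_evalVec_sq]
  rw [integral_finsetSum _ fun m _ => (Lp.memLp (w m)).integrable_sq]
  refine Finset.sum_le_sum fun m _ => ?_
  rw [← eLpNorm_two_toReal_sq (Lp.memLp (w m)), ← Lp.norm_def]
  exact pow_le_pow_left₀ (norm_nonneg _) (norm_le_normH4 _) 2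

theorem ae_evalVec_sub (w w' : Fin N → L2 d) :
    ∀ᵐ x, evalVec (w - w') x = evalVec w x - evalVec w' x := by
  filter_upwards [ae_all_iff.2 fun m => Lp.coeFn_sub (w m) (w' m)] with x hx
  ext m
  exact hx m

theorem ae_evalVec_add (w w' : Fin N → L2 d) :
    ∀ᵐ x, evalVec (w + w') x = evalVec w x + evalVec w' x := by
  filter_upwards [ae_all_iff.2 fun m => Lp.coeFn_add (w m) (w' m)] with x hx
  ext m
  exact hx m

theorem ae_evalVec_zero : ∀ᵐ x, evalVec (0 : Fin N → L2 d) x = 0 := by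
  filter_upwards [ae_evalVec_sub (0 : Fin N → L2 d) 0] with x hx
  simpa using hx

/-- Nothing is known about h off I; replacing it there by 0 gives a Borel function and changes the
composition only on a null set. -/
theorem aestronglyMeasurable_comp_evalVec {I : Set (Rn N)} (hI : IsClosed I) {h : Rn N → ℝ}
    (hh : ContinuousOn h I) {w : Fin N → L2 d} (hw : ∀ᵐ x, evalVec w x ∈ I) :
    AEStronglyMeasurable (fun x => h (evalVec w x)) volume := by
  classical
  have hm : Measurable (I.piecewise h 0) :=
    hh.measurable_piecewise continuousOn_const hI.measurableSet
  refine (hm.comp (measurable_evalVec w)).aestronglyMeasurable.congr ?_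
  filter_upwards [hw] with x hx
  exact Set.piecewise_eq_of_mem _ _ _ hx

/-- The increments of a nonlinearity along two functions in `H⁴` belong to `L¹ ∩ L²`. -/
theorem increment_estimates {r : ℝ} (hr : 0 < r) {h : Rn N → ℝ}
    (hh : ContDiffOn ℝ 2 h (Metric.closedBall 0 r)) (h0 : fderiv ℝ h 0 = 0) {B : ℝ}
    (hB : normC2 (Metric.closedBall 0 r) h ≤ B) {w w' : Fin N → L2 d}
    (hw : ∀ᵐ x, evalVec w x ∈ Metric.closedBall (0 : Rn N) r)
    (hw' : ∀ᵐ x, evalVec w' x ∈ Metric.closedBall (0 : Rn N) r) {K : ℝ}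
    (hK : normH4Vec w ≤ K) (hK' : normH4Vec w' ≤ K) :
    MemLp (fun x => h (evalVec w x) - h (evalVec w' x)) 2 volume ∧
    Integrable (fun x => h (evalVec w x) - h (evalVec w' x)) volume ∧
    ∫ x, |h (evalVec w x) - h (evalVec w' x)| ≤ B * normH4Vec (w - w') * K ∧
    (eLpNorm (fun x => h (evalVec w x) - h (evalVec w' x)) 2 volume).toReal ≤
      B * normH4Vec (w - w') := by
  have hB0 : 0 ≤ B := (normC2_nonneg _ _).trans hB
  set G := fun x => h (evalVec w x) - h (evalVec w' x) with hG
  set n := fun x => ‖evalVec w x‖ with hn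
  set n' := fun x => ‖evalVec w' x‖ with hn'
  set D := fun x => ‖evalVec (w - w') x‖ with hD
  have hnL := memLp_norm_evalVec w
  have hnL' := memLp_norm_evalVec w'
  have hDL := memLp_norm_evalVec (w - w')
  have hGm : AEStronglyMeasurable G volume :=
    (aestronglyMeasurable_comp_evalVec Metric.isClosed_closedBall hh.continuousOn hw).sub
      (aestronglyMeasurable_comp_evalVec Metric.isClosed_closedBall hh.continuousOn hw')
  -- The Lipschitz bound serves the L² estimate, which therefore carries no factor K.
  have b1 : ∀ᵐ x, ‖G x‖ ≤ B * D x := by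
    filter_upwards [hw, hw', ae_evalVec_sub w w'] with x a1 a2 a3
    simp only [hD, a3]
    exact (abs_sub_le_normC2_mul hr hh a1 a2).trans
      (mul_le_mul_of_nonneg_right hB (norm_nonneg _))
  -- The quadratic bound gives products of two L² functions, hence integrability, at the cost of a
  -- factor K.
  have b2 : ∀ᵐ x, ‖G x‖ ≤ B / 2 * (n x * D x + n' x * D x) := by
    filter_upwards [hw, hw', ae_evalVec_sub w w'] with x a1 a2 a3
    simp only [hD, a3]
    refine ((abs_sub_le_normC2_mul_add_norm hr hh h0 a1 a2).trans
      (mul_le_mul_of_nonneg_right hB (by positivity))).trans_eq ?_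
    simp only [hn, hn']; ring
  have hGL : MemLp G 2 volume := hDL.of_le_mul hGm (c := B) (by
    filter_upwards [b1] with x hx
    rwa [Real.norm_of_nonneg (norm_nonneg _)])
  have i1 : Integrable (fun x => n x * D x) volume := hnL.integrable_mul hDL
  have i2 : Integrable (fun x => n' x * D x) volume := hnL'.integrable_mul hDL
  have i3 : Integrable (fun x => B / 2 * (n x * D x + n' x * D x)) volume :=
    (i1.add i2).const_mul _
  have hGi : Integrable G volume := i3.mono' hGm b2
  have hδ := eLpNorm_norm_evalVec_le (w - w')
  refine ⟨hGL, hGi, ?_, ?_⟩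
  · calc ∫ x, |G x| ≤ ∫ x, B / 2 * (n x * D x + n' x * D x) := integral_mono_ae hGi.abs i3 b2
      _ = B / 2 * ((∫ x, n x * D x) + ∫ x, n' x * D x) := by
        rw [integral_const_mul, integral_add i1 i2]
      _ ≤ B / 2 * (K * normH4Vec (w - w') + K * normH4Vec (w - w')) := by
        gcongr
        · refine (integral_mul_le_eLpNorm_two_mul hnL hDL).trans (mul_le_mul
            ((eLpNorm_norm_evalVec_le w).trans hK) hδ ENNReal.toReal_nonneg
            ((normH4Vec_nonneg w).trans hK))
        · refine (integral_mul_le_eLpNorm_two_mul hnL' hDL).trans (mul_le_mul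
            ((eLpNorm_norm_evalVec_le w').trans hK') hδ ENNReal.toReal_nonneg
            ((normH4Vec_nonneg w).trans hK))
      _ = _ := by ring
  · have h1 : eLpNorm G 2 volume ≤ ENNReal.ofReal B * eLpNorm D 2 volume := by
      refine eLpNorm_le_mul_eLpNorm_of_ae_le_mul ?_ 2
      filter_upwards [b1] with x hx
      rwa [Real.norm_of_nonneg (norm_nonneg _)]
    have h2 := ENNReal.toReal_mono (ENNReal.mul_ne_top ENNReal.ofReal_ne_top hDL.2.ne) h1
    rw [ENNReal.toReal_mul, ENNReal.toReal_ofReal hB0] at h2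
    exact h2.trans (mul_le_mul_of_nonneg_left hδ hB0)

theorem sphereMeasure_pos (hd : 0 < d) : 0 < sphereMeasure d := by
  have : Nonempty (Fin d) := ⟨⟨0, hd⟩⟩
  rw [sphereMeasure, Measure.toSphere_real_apply_univ, finrank_euclideanSpace_fin]
  have h : 0 < (volume : Measure (Rn d)).real (Metric.ball 0 1) :=
    ENNReal.toReal_pos (Metric.measure_ball_pos _ _ one_pos).ne' measure_ball_lt_top.ne
  positivity

/-- The low and high frequency terms at the optimal splitting radius. -/
theorem exists_optimal_radius (hd : 5 ≤ d) {K : ℝ} (hK : 0 < K) :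
    ∃ R : ℝ, 0 < R ∧ ∀ a b L : ℝ, ((2 * Real.pi) ^ 4)⁻¹ *
      ((a * (L * K)) ^ 2 * (sphereMeasure d * R ^ (d - 4) / ((d : ℝ) - 4)) +
        (a * L) ^ 2 * (R ^ 4)⁻¹) + (b * (L * K)) ^ 2 =
      L ^ 2 * K ^ 2 * (a ^ 2 * K ^ (8 / (d : ℝ) - 2) * (sphereMeasure d / 4) ^ (4 / (d : ℝ)) *
        ((d : ℝ) / (((d : ℝ) - 4) * (2 * Real.pi) ^ 4)) + b ^ 2) := by
  have hS := sphereMeasure_pos (d := d) (by omega)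
  set S := sphereMeasure d
  have hd0 : (0 : ℝ) < d := by exact_mod_cast (by omega : 0 < d)
  have hd4 : (0 : ℝ) < (d : ℝ) - 4 := by
    have : (5 : ℝ) ≤ d := by exact_mod_cast hd
    linarith
  -- This is the minimizer of K² S R^(d-4)/(d-4) + R⁻⁴. There K² S R^(d-4) = 4R⁻⁴, so the minimum is
  -- d/(d-4) · R⁻⁴.
  set R : ℝ := (4 / (K ^ 2 * S)) ^ (1 / (d : ℝ)) with hR
  have hR0 : 0 < R := by positivity
  have hRd : R ^ d = 4 / (K ^ 2 * S) := by
    rw [hR, ← Real.rpow_natCast, ← Real.rpow_mul (by positivity), one_div_mul_cancel hd0.ne',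
      Real.rpow_one]
  have hRd4 : K ^ 2 * S * R ^ (d - 4) = 4 * (R ^ 4)⁻¹ := by
    have : R ^ d = R ^ (d - 4) * R ^ 4 := by rw [← pow_add]; congr 1; omega
    rw [this] at hRd
    field_simp
    field_simp at hRd
    linarith
  have hR4 : (R ^ 4)⁻¹ = K ^ 2 * K ^ (8 / (d : ℝ) - 2) * (S / 4) ^ (4 / (d : ℝ)) := by
    have e1 : K ^ 2 * K ^ (8 / (d : ℝ) - 2) = K ^ (8 / (d : ℝ)) := by
      rw [← Real.rpow_natCast K 2, ← Real.rpow_add hK]; congr 1; push_cast; ring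
    have e2 : R ^ 4 = (4 / (K ^ 2 * S)) ^ (4 / (d : ℝ)) := by
      rw [hR, ← Real.rpow_natCast, ← Real.rpow_mul (by positivity)]; congr 1; push_cast; ring
    have e3 : K ^ (8 / (d : ℝ)) = (K ^ 2) ^ (4 / (d : ℝ)) := by
      rw [← Real.rpow_natCast K 2, ← Real.rpow_mul hK.le]; congr 1; push_cast; ring
    rw [e1, e2, e3, ← Real.inv_rpow (by positivity), ← Real.mul_rpow (by positivity) (by positivity)]
    congr 1
    field_simp
  refine ⟨R, hR0, fun a b L => ?_⟩
  calc _ = a ^ 2 * L ^ 2 * ((2 * Real.pi) ^ 4)⁻¹ *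
          (K ^ 2 * S * R ^ (d - 4) / ((d : ℝ) - 4) + (R ^ 4)⁻¹) + (b * (L * K)) ^ 2 := by ring
    _ = a ^ 2 * L ^ 2 * (R ^ 4)⁻¹ * ((d : ℝ) / (((d : ℝ) - 4) * (2 * Real.pi) ^ 4)) +
          (b * (L * K)) ^ 2 := by
        rw [hRd4]
        congr 1
        have := Real.pi_pos
        field_simp
        ring
    _ = _ := by rw [hR4]; ring

theorem integral_abs_eq_eLpNorm_one {H : Rn d → ℝ} (hH : MemLp H 1 volume) :
    ∫ x, |H x| = (eLpNorm H 1 volume).toReal := by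
  rw [eLpNorm_one_eq_lintegral_enorm]
  exact integral_norm_eq_lintegral_enorm hH.1

/-- Young's inequality enters in three ways: ‖H‖₁‖G‖₁ at low frequencies, ‖H‖₁‖G‖₂ at high
frequencies, and ‖H‖₂‖G‖₁ for Δ²u. The first two combine into the term with ‖H‖₁², the last gives
‖H‖₂². -/
theorem normH4_sq_le_of_solvesPoisson_conv (hd : 5 ≤ d) {H G : Rn d → ℝ} (hH1 : MemLp H 1 volume)
    (hH2 : MemLp H 2 volume) (hG1 : Integrable G volume) (hG2 : MemLp G 2 volume) {K L e E : ℝ}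
    (hK : 0 < K) (he : 0 ≤ e) (heE : e ≤ E) (hGK : ∫ x, |G x| ≤ L * K)
    (hGL : (eLpNorm G 2 volume).toReal ≤ L) {u : L2 d}
    (hu : SolvesPoisson (fun x => e * conv H G x) u) :
    normH4 u ^ 2 ≤ E ^ 2 * L ^ 2 * K ^ 2 * ((eLpNorm H 1 volume).toReal ^ 2 *
      (K ^ (8 / (d : ℝ) - 2) * (sphereMeasure d / 4) ^ (4 / (d : ℝ)) *
        ((d : ℝ) / (((d : ℝ) - 4) * (2 * Real.pi) ^ 4))) + (eLpNorm H 2 volume).toReal ^ 2) := by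
  have hH := memLp_one_iff_integrable.1 hH1
  have hL : 0 ≤ L := ENNReal.toReal_nonneg.trans hGL
  have hnorm : (eLpNorm (fun x => e * conv H G x) 2 volume).toReal =
      e * (eLpNorm (conv H G) 2 volume).toReal := by
    have := eLpNorm_const_smul e (conv H G) 2 volume
    rw [show (fun x => e * conv H G x) = e • conv H G from rfl, this, ENNReal.toReal_mul,
      ← ofReal_norm, Real.norm_of_nonneg he, ENNReal.toReal_ofReal he]
  obtain ⟨R, hR, hopt⟩ := exists_optimal_radius hd hK
  have hα : ∫ x, |e * conv H G x| ≤ (eLpNorm H 1 volume).toReal * (e * L * K) := by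
    simp only [abs_mul, abs_of_nonneg he]
    rw [integral_const_mul, ← integral_abs_eq_eLpNorm_one hH1]
    calc e * ∫ x, |conv H G x| ≤ e * ((∫ x, |H x|) * (L * K)) := by
          gcongr
          refine (integral_abs_conv_le hH hG1).trans (mul_le_mul_of_nonneg_left hGK ?_)
          exact integral_nonneg fun _ => abs_nonneg _
      _ = _ := by ring
  have hβ : (eLpNorm (fun x => e * conv H G x) 2 volume).toReal ≤
      (eLpNorm H 1 volume).toReal * (e * L) := by
    -- Exchanging the factors puts the L² norm on G and the L¹ norm on H.
    rw [hnorm, conv_comm, ← integral_abs_eq_eLpNorm_one hH1]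
    calc e * (eLpNorm (conv G H) 2 volume).toReal ≤ e * (L * ∫ x, |H x|) := by
          gcongr
          refine (eLpNorm_two_conv_le hG1 hG2 hH).trans (mul_le_mul_of_nonneg_right hGL ?_)
          exact integral_nonneg fun _ => abs_nonneg _
      _ = _ := by ring
  have hγ : (eLpNorm (fun x => e * conv H G x) 2 volume).toReal ≤
      (eLpNorm H 2 volume).toReal * (e * L * K) := by
    rw [hnorm]
    calc e * (eLpNorm (conv H G) 2 volume).toReal ≤ e * ((eLpNorm H 2 volume).toReal * (L * K)) := by
          gcongr
          exact (eLpNorm_two_conv_le hH hH2 hG1).trans (by gcongr)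
      _ = _ := by ring
  have h := hu.normH4_sq_le hd ((integrable_conv hH hG1).const_mul e) hα hβ hγ hR
  rw [hopt] at h
  have hd4 : (0 : ℝ) < (d : ℝ) - 4 := by
    have : (5 : ℝ) ≤ d := by exact_mod_cast hd
    linarith
  have hS := sphereMeasure_pos (d := d) (by omega)
  refine h.trans ?_
  calc _ = e ^ 2 * (L ^ 2 * K ^ 2 * ((eLpNorm H 1 volume).toReal ^ 2 *
      (K ^ (8 / (d : ℝ) - 2) * (sphereMeasure d / 4) ^ (4 / (d : ℝ)) *
        ((d : ℝ) / (((d : ℝ) - 4) * (2 * Real.pi) ^ 4))) + (eLpNorm H 2 volume).toReal ^ 2)) := by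
        ring
    _ ≤ E ^ 2 * (L ^ 2 * K ^ 2 * ((eLpNorm H 1 volume).toReal ^ 2 *
      (K ^ (8 / (d : ℝ) - 2) * (sphereMeasure d / 4) ^ (4 / (d : ℝ)) *
        ((d : ℝ) / (((d : ℝ) - 4) * (2 * Real.pi) ^ 4))) + (eLpNorm H 2 volume).toReal ^ 2)) := by
        gcongr
    _ = _ := by ring

theorem le_epsMax (ε : Fin N → ℝ) (m : Fin N) : ε m ≤ epsMax ε :=
  le_ciSup (Set.finite_range ε).bddAbove m

theorem bracket_pos (hd : 5 ≤ d) {H : Fin N → Rn d → ℝ} (hQ : 0 < kernelSq 2 H)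
    (u₀ : Fin N → L2 d) : 0 < bracket H u₀ := by
  have hd4 : (0 : ℝ) < (d : ℝ) - 4 := by
    have : (5 : ℝ) ≤ d := by exact_mod_cast hd
    linarith
  have hS := sphereMeasure_pos (d := d) (by omega)
  have hK : 0 < normH4Vec u₀ + 1 := by linarith [normH4Vec_nonneg u₀]
  have hH : 0 ≤ kernelSq 1 H := Finset.sum_nonneg fun _ _ => sq_nonneg _
  unfold bracket
  positivity

/-- The estimate of the solution of a system with convolution source terms. -/
theorem normH4Vec_le_of_solvesPoisson_conv (hd : 5 ≤ d) {f H : Fin N → Rn d → ℝ}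
    (hfH : AdmissibleData f H) {ε : Fin N → ℝ} (hε : ∀ m, 0 ≤ ε m) (hε0 : 0 ≤ epsMax ε)
    {u₀ : Fin N → L2 d} {G : Fin N → Rn d → ℝ} (hG1 : ∀ m, Integrable (G m) volume)
    (hG2 : ∀ m, MemLp (G m) 2 volume) {L : ℝ} (hL : 0 ≤ L)
    (hGK : ∀ m, ∫ x, |G m x| ≤ L * (normH4Vec u₀ + 1))
    (hGL : ∀ m, (eLpNorm (G m) 2 volume).toReal ≤ L) {u : Fin N → L2 d}
    (hu : ∀ m, SolvesPoisson (fun x => ε m * conv (H m) (G m) x) (u m)) :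
    normH4Vec u ≤ epsMax ε * L * (normH4Vec u₀ + 1) * bracket H u₀ ^ (1 / 2 : ℝ) := by
  have hK : 0 < normH4Vec u₀ + 1 := by linarith [normH4Vec_nonneg u₀]
  have hA := bracket_pos hd hfH.Q_pos u₀
  refine le_of_sq_le_sq ?_ (by positivity)
  rw [← Real.sqrt_eq_rpow, mul_pow, Real.sq_sqrt hA.le, normH4Vec_sq]
  refine (Finset.sum_le_sum fun m _ => normH4_sq_le_of_solvesPoisson_conv hd (hfH.H_L1 m)
    (hfH.H_L2 m) (hG1 m) (hG2 m) hK (hε m) (le_epsMax ε m) (hGK m) (hGL m) (hu m)).trans_eq ?_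
  rw [← Finset.mul_sum, Finset.sum_add_distrib, ← Finset.sum_mul, bracket, kernelSq, kernelSq]
  ring

end Estimates

/-! ### The solution operator of the auxiliary system and its dependence on v and g. -/

section Main

variable {d N : ℕ}

/-- The properties of a nonlinearity which are used for the estimates. -/
structure QuadraticNonlinearity (r B : ℝ) (h : Fin N → Rn N → ℝ) : Prop where
  zero : ∀ m, h m 0 = 0
  grad_zero : ∀ m, fderiv ℝ (h m) 0 = 0
  contDiffOn : ∀ m, ContDiffOn ℝ 2 (h m) (Metric.closedBall 0 r)
  norm_le : ∀ m, normC2 (Metric.closedBall 0 r) (h m) ≤ B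

theorem ae_evalVec_mem_ballI (hd : d ≤ 7) {ce : ℝ} (hce : sobolevConst d ≤ ce)
    {u₀ w : Fin N → L2 d} (hw : w ∈ H4Vec d N) (hwK : normH4Vec w ≤ normH4Vec u₀ + 1) :
    ∀ᵐ x, evalVec w x ∈ Metric.closedBall (0 : Rn N) (ce * normH4Vec u₀ + ce) := by
  filter_upwards [ae_norm_evalVec_le hd hce hw] with x hx
  rw [mem_closedBall_zero_iff]
  refine hx.trans ((mul_le_mul_of_nonneg_left hwK (sobolevConst_nonneg.trans hce)).trans_eq ?_)
  ring

/-- Because h vanishes at the origin, h ∘ w is the increment of h between w and the zero function.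
-/
theorem memLp_comp_evalVec {r B : ℝ} (hr : 0 < r) {h : Fin N → Rn N → ℝ}
    (hh : QuadraticNonlinearity r B h) {w : Fin N → L2 d}
    (hw : ∀ᵐ x, evalVec w x ∈ Metric.closedBall (0 : Rn N) r) (m : Fin N) :
    MemLp (h m ∘ evalVec w) 2 volume ∧ Integrable (h m ∘ evalVec w) volume := by
  have hw0 : ∀ᵐ x, evalVec (0 : Fin N → L2 d) x ∈ Metric.closedBall (0 : Rn N) r := by
    filter_upwards [ae_evalVec_zero (d := d) (N := N)] with x hx
    rw [hx]
    exact Metric.mem_closedBall_self hr.le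
  have h1 := increment_estimates hr (hh.contDiffOn m) (hh.grad_zero m) (hh.norm_le m) hw hw0
    (K := normH4Vec w) le_rfl (normH4Vec_zero.trans_le (normH4Vec_nonneg w))
  have hae : (fun x => h m (evalVec w x) - h m (evalVec (0 : Fin N → L2 d) x)) =ᵐ[volume]
      h m ∘ evalVec w := by
    filter_upwards [ae_evalVec_zero (d := d) (N := N)] with x hx
    rw [hx, hh.zero m, sub_zero]; rfl
  exact ⟨(memLp_congr_ae hae).1 h1.1, h1.2.1.congr hae⟩

theorem production_congr {e : ℝ} {H : Rn d → ℝ} {g : Rn N → ℝ} {w w' : Rn d → Rn N}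
    (h : w =ᵐ[volume] w') : production e H g w = production e H g w' := by
  rw [production_eq_mul_conv, production_eq_mul_conv,
    conv_congr (h.mono fun x hx => congrArg g hx : g ∘ w =ᵐ[volume] g ∘ w')]

/-- The solutions of the system with frozen nonlinearity. -/
def SolvesFrozen (ε : Fin N → ℝ) (H : Fin N → Rn d → ℝ) (h : Fin N → Rn N → ℝ)
    (w u : Fin N → L2 d) : Prop :=
  ∀ m, SolvesPoisson (production (ε m) (H m) (h m) (evalVec w)) (u m)

theorem solvesAux_iff_solvesFrozen {ε : Fin N → ℝ} {H : Fin N → Rn d → ℝ} {g : Fin N → Rn N → ℝ}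
    {u₀ v u : Fin N → L2 d} : SolvesAux ε H g u₀ v u ↔ SolvesFrozen ε H g (u₀ + v) u := by
  refine forall_congr' fun m => ?_
  rw [production_congr (ae_evalVec_add u₀ v)]

theorem SolvesFrozen.unique (hd : 0 < d) {ε : Fin N → ℝ} {H : Fin N → Rn d → ℝ}
    {h : Fin N → Rn N → ℝ} {w u u' : Fin N → L2 d} (hu : SolvesFrozen ε H h w u)
    (hu' : SolvesFrozen ε H h w u') : u = u' :=
  funext fun m => (hu m).unique hd (hu' m)

theorem exists_solvesFrozen (hd : 5 ≤ d) {f H : Fin N → Rn d → ℝ} (hfH : AdmissibleData f H)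
    (ε : Fin N → ℝ) {r B : ℝ} (hr : 0 < r) {h : Fin N → Rn N → ℝ}
    (hh : QuadraticNonlinearity r B h) {w : Fin N → L2 d}
    (hw : ∀ᵐ x, evalVec w x ∈ Metric.closedBall (0 : Rn N) r) :
    ∃ u, SolvesFrozen ε H h w u := by
  have hex : ∀ m, ∃ u, SolvesPoisson (production (ε m) (H m) (h m) (evalVec w)) u := fun m => by
    obtain ⟨-, h1⟩ := memLp_comp_evalVec hr hh hw m
    have hH := memLp_one_iff_integrable.1 (hfH.H_L1 m)
    exact exists_solvesPoisson hd ((integrable_conv hH h1).const_mul _)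
      ((memLp_two_conv hH (hfH.H_L2 m) h1).const_mul _)
  choose u hu using hex
  exact ⟨u, hu⟩

/-- A reference solution, through which bounds on a single solution follow from bounds on
differences. -/
theorem solvesFrozen_zero (ε : Fin N → ℝ) (H : Fin N → Rn d → ℝ) {h : Fin N → Rn N → ℝ}
    (hh : ∀ m, h m 0 = 0) : SolvesFrozen ε H h 0 0 := by
  intro m
  have h0 : production (ε m) (H m) (h m) (evalVec (0 : Fin N → L2 d)) = 0 := by
    rw [production_congr (w' := fun _ => 0) ae_evalVec_zero]
    ext x
    simp [production, hh m]
  have hL : Δ (0 : 𝓢'(Rn d, ℂ)) = 0 := by simpa using laplacian_sub (0 : 𝓢'(Rn d, ℂ)) 0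
  rw [h0]
  refine ⟨zero_mem_H4, MemLp.zero, ?_⟩
  rw [MemLp.toLp_zero, Pi.zero_apply, toDistr_zero, hL, hL]
  simp

/-- The estimate of the increments of the solutions. -/
theorem SolvesFrozen.normH4Vec_sub_le (hd : 5 ≤ d) {f H : Fin N → Rn d → ℝ}
    (hfH : AdmissibleData f H) {ε : Fin N → ℝ} (hε : ∀ m, 0 ≤ ε m) (hε0 : 0 ≤ epsMax ε)
    {r B : ℝ} (hr : 0 < r) (hB0 : 0 ≤ B) {h : Fin N → Rn N → ℝ}
    (hh : QuadraticNonlinearity r B h) {u₀ w w' u u' : Fin N → L2 d}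
    (hw : ∀ᵐ x, evalVec w x ∈ Metric.closedBall (0 : Rn N) r)
    (hw' : ∀ᵐ x, evalVec w' x ∈ Metric.closedBall (0 : Rn N) r)
    (hwK : normH4Vec w ≤ normH4Vec u₀ + 1) (hwK' : normH4Vec w' ≤ normH4Vec u₀ + 1)
    (hu : SolvesFrozen ε H h w u) (hu' : SolvesFrozen ε H h w' u') :
    normH4Vec (u - u') ≤ epsMax ε * (B * normH4Vec (w - w')) * (normH4Vec u₀ + 1) *
      bracket H u₀ ^ (1 / 2 : ℝ) := by
  have hinc := fun m => increment_estimates hr (hh.contDiffOn m) (hh.grad_zero m) (hh.norm_le m)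
    hw hw' hwK hwK'
  refine normH4Vec_le_of_solvesPoisson_conv hd hfH hε hε0 (fun m => (hinc m).2.1)
    (fun m => (hinc m).1) (mul_nonneg hB0 (normH4Vec_nonneg _)) (fun m => (hinc m).2.2.1)
    (fun m => (hinc m).2.2.2) fun m => ?_
  have h1 := (hu m).sub (hu' m)
  have h2 := conv_sub (hfH.H_L2 m) (memLp_comp_evalVec hr hh hw m).1
    (memLp_comp_evalVec hr hh hw' m).1
  refine h1.congr (.of_forall fun x => ?_)
  have h3 := congrFun h2 x
  simp only [production_eq_mul_conv, Pi.sub_apply, ← mul_sub] at h3 ⊢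
  rw [← h3]
  rfl

theorem SolvesFrozen.normH4Vec_le (hd : 5 ≤ d) {f H : Fin N → Rn d → ℝ}
    (hfH : AdmissibleData f H) {ε : Fin N → ℝ} (hε : ∀ m, 0 ≤ ε m) (hε0 : 0 ≤ epsMax ε)
    {r B : ℝ} (hr : 0 < r) (hB0 : 0 ≤ B) {h : Fin N → Rn N → ℝ}
    (hh : QuadraticNonlinearity r B h) {u₀ w u : Fin N → L2 d}
    (hw : ∀ᵐ x, evalVec w x ∈ Metric.closedBall (0 : Rn N) r)
    (hwK : normH4Vec w ≤ normH4Vec u₀ + 1) (hu : SolvesFrozen ε H h w u) :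
    normH4Vec u ≤ epsMax ε * (B * (normH4Vec u₀ + 1)) * (normH4Vec u₀ + 1) *
      bracket H u₀ ^ (1 / 2 : ℝ) := by
  have hw0 : ∀ᵐ x, evalVec (0 : Fin N → L2 d) x ∈ Metric.closedBall (0 : Rn N) r := by
    filter_upwards [ae_evalVec_zero (d := d) (N := N)] with x hx
    rw [hx]
    exact Metric.mem_closedBall_self hr.le
  have hK : 0 ≤ normH4Vec u₀ + 1 := by linarith [normH4Vec_nonneg u₀]
  have h1 := SolvesFrozen.normH4Vec_sub_le hd hfH hε hε0 hr hB0 hh (u₀ := u₀) hw hw0 hwK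
    (normH4Vec_zero.trans_le hK) hu (solvesFrozen_zero ε H hh.zero)
  rw [sub_zero, sub_zero] at h1
  refine h1.trans ?_
  have hA := (bracket_pos hd hfH.Q_pos u₀).le
  gcongr

/-- If u₀ vanished, so would every f_m. Strictness makes ‖u₀‖ + 1 > 1, which gives εκ < 1 even when
ρ = 1. -/
theorem SolvesLinear.normH4Vec_pos {f H : Fin N → Rn d → ℝ} (hfH : AdmissibleData f H)
    {u₀ : Fin N → L2 d} (hu₀ : SolvesLinear f u₀) : 0 < normH4Vec u₀ := by
  refine (normH4Vec_nonneg u₀).lt_of_ne' fun h => ?_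
  obtain ⟨m, hm⟩ := hfH.f_nontrivial
  have h1 := normH4Vec_sq u₀
  rw [h, zero_pow two_ne_zero, eq_comm, Finset.sum_eq_zero_iff_of_nonneg fun _ _ => sq_nonneg _] at h1
  have h2 : u₀ m = 0 := by
    have h3 := norm_le_normH4 (u₀ m)
    rw [pow_eq_zero_iff two_ne_zero |>.1 (h1 m (Finset.mem_univ m))] at h3
    exact norm_le_zero_iff.1 h3
  obtain ⟨-, hF, h4⟩ := hu₀ m
  have hL : Δ (0 : 𝓢'(Rn d, ℂ)) = 0 := by simpa using laplacian_sub (0 : 𝓢'(Rn d, ℂ)) 0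
  rw [h2, toDistr_zero, hL, hL, neg_zero, add_zero, ← toDistr_zero] at h4
  have h5 := toDistr_injective h4.symm
  refine hm ?_
  filter_upwards [hF.coeFn_toLp, Lp.coeFn_zero ℝ 2 (volume : Measure (Rn d))] with x a1 a2
  rw [← a1, h5, a2]

/-- With radius zero, I would be the origin alone, where g vanishes, contrary to its nontriviality
on I. Positivity makes I a neighbourhood of 0, as the derivative arguments require. -/
theorem radius_pos {ce : ℝ} (hce : sobolevConst d ≤ ce) {u₀ : Fin N → L2 d} {M : ℝ}
    {g : Fin N → Rn N → ℝ} (hg : AdmissibleNonlinearity (ballI ce u₀) M g) :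
    0 < ce * normH4Vec u₀ + ce := by
  have hce0 := sobolevConst_nonneg.trans hce
  have h0 : 0 ≤ ce * normH4Vec u₀ + ce :=
    add_nonneg (mul_nonneg hce0 (normH4Vec_nonneg u₀)) hce0
  refine h0.lt_of_ne' fun h => ?_
  obtain ⟨z, hz, m, hm⟩ := hg.nontrivial
  rw [ballI, h, Metric.closedBall_zero, Set.mem_singleton_iff] at hz
  exact hm (by rw [hz]; exact hg.zero m)

theorem AdmissibleNonlinearity.quadraticNonlinearity {ce : ℝ} {u₀ : Fin N → L2 d} {M : ℝ}
    {g : Fin N → Rn N → ℝ} (hg : AdmissibleNonlinearity (ballI ce u₀) M g) :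
    QuadraticNonlinearity (ce * normH4Vec u₀ + ce) M g :=
  ⟨hg.zero, hg.grad_zero, hg.contDiffOn, fun m => (normC2_le_normC2Vec _ g m).trans hg.norm_le⟩

/-- The difference is bounded by its own C² norm rather than by B + B'; this is how ‖g₁ - g₂‖ enters
the stability estimate. -/
theorem QuadraticNonlinearity.sub {r B B' : ℝ} (hr : 0 < r) {g g' : Fin N → Rn N → ℝ}
    (hg : QuadraticNonlinearity r B g) (hg' : QuadraticNonlinearity r B' g') :
    QuadraticNonlinearity r (normC2Vec (Metric.closedBall 0 r) (g - g')) (g - g') := by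
  have hI : Metric.closedBall (0 : Rn N) r ∈ nhds (0 : Rn N) := Metric.closedBall_mem_nhds 0 hr
  refine ⟨fun m => ?_, fun m => ?_, fun m => (hg.contDiffOn m).sub (hg'.contDiffOn m),
    normC2_le_normC2Vec _ _⟩
  · simp [hg.zero m, hg'.zero m]
  · have h1 := ((hg.contDiffOn m).contDiffAt hI).differentiableAt (by norm_num)
    have h2 := ((hg'.contDiffOn m).contDiffAt hI).differentiableAt (by norm_num)
    rw [Pi.sub_apply, fderiv_sub h1 h2, hg.grad_zero, hg'.grad_zero, sub_zero]

theorem SolvesFrozen.sub {f H : Fin N → Rn d → ℝ} (hfH : AdmissibleData f H) {ε : Fin N → ℝ}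
    {r B B' : ℝ} (hr : 0 < r) {g g' : Fin N → Rn N → ℝ} (hg : QuadraticNonlinearity r B g)
    (hg' : QuadraticNonlinearity r B' g') {w u u' : Fin N → L2 d}
    (hw : ∀ᵐ x, evalVec w x ∈ Metric.closedBall (0 : Rn N) r)
    (hu : SolvesFrozen ε H g w u) (hu' : SolvesFrozen ε H g' w u') :
    SolvesFrozen ε H (g - g') w (u - u') := by
  intro m
  have h2 := conv_sub (hfH.H_L2 m) (memLp_comp_evalVec hr hg hw m).1
    (memLp_comp_evalVec hr hg' hw m).1
  refine ((hu m).sub (hu' m)).congr (.of_forall fun x => ?_)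
  have h3 := congrFun h2 x
  simp only [production_eq_mul_conv, Pi.sub_apply, ← mul_sub] at h3 ⊢
  rw [← h3]
  rfl

end Main

end

/-! ### The fixed points and their stability. -/

theorem theorem1p5 (d N : ℕ) (hd5 : 5 ≤ d) (hd7 : d ≤ 7) (hN : 2 ≤ N)
    (f H : Fin N → Rn d → ℝ) (hfH : AdmissibleData f H)
    (u₀ : Fin N → L2 d) (hu₀ : SolvesLinear f u₀)
    (ce : ℝ) (hce : sobolevConst d ≤ ce)
    (M : ℝ) (hM : 0 < M)
    (g : Fin 2 → Fin N → Rn N → ℝ) (hg : ∀ j, AdmissibleNonlinearity (ballI ce u₀) M (g j))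
    (ρ : ℝ) (hρ0 : 0 < ρ) (hρ1 : ρ ≤ 1)
    (ε : Fin N → ℝ) (hε : ∀ m, 0 ≤ ε m)
    (hεpos : 0 < epsMax ε) (hεbound : epsMax ε ≤ epsBound M ρ H u₀) :
    ∃ (T : Fin 2 → ballH4 d N ρ → ballH4 d N ρ) (up : Fin 2 → ballH4 d N ρ),
      (∀ j, IsSolutionMap ε H (g j) u₀ (T j) ∧ IsStrictContraction (T j) ∧
        (∀ v, T j v = v ↔ v = up j) ∧
        SolvesStationary ε H (g j) f (u₀ + (up j).1)) ∧
      epsMax ε * kappa M H u₀ < 1 ∧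
      normH4Vec ((u₀ + (up 0).1) - (u₀ + (up 1).1)) ≤
        epsMax ε * kappa M H u₀ / (M * (1 - epsMax ε * kappa M H u₀)) * (normH4Vec u₀ + 1) *
          normC2Vec (ballI ce u₀) (g 0 - g 1) := by
  set K := normH4Vec u₀ + 1 with hK
  set A := bracket H u₀ with hA
  set E := epsMax ε with hE
  have hu₀H : u₀ ∈ H4Vec d N := fun m => (hu₀ m).1
  have hu₀pos : 0 < normH4Vec u₀ := SolvesLinear.normH4Vec_pos hfH hu₀
  have hK1 : 1 < K := by linarith
  have hK0 : 0 < K := by linarith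
  have hApos : 0 < A := bracket_pos hd5 hfH.Q_pos u₀
  have hA12 : 0 < A ^ (1 / 2 : ℝ) := by positivity
  have hr : 0 < ce * normH4Vec u₀ + ce := radius_pos hce (hg 0)
  have hquad := fun j => (hg j).quadraticNonlinearity
  have hκ : kappa M H u₀ = M * K * A ^ (1 / 2 : ℝ) := rfl
  -- This is the assumed bound on ε rewritten: its K² supplies one K for κ and one for the size of
  -- u₀ + v.
  have hEκρ : E * kappa M H u₀ * K ≤ ρ := by
    have h1 : epsBound M ρ H u₀ * (M * K ^ 2 * A ^ (1 / 2 : ℝ)) = ρ := by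
      have h2 : A ^ (-(1 / 2) : ℝ) * A ^ (1 / 2 : ℝ) = 1 := by
        rw [← Real.rpow_add hApos]; norm_num
      have h3 : epsBound M ρ H u₀ = ρ / (M * K ^ 2) * A ^ (-(1 / 2) : ℝ) := rfl
      calc _ = ρ / (M * K ^ 2) * (M * K ^ 2) * (A ^ (-(1 / 2) : ℝ) * A ^ (1 / 2 : ℝ)) := by
            rw [h3]; ring
        _ = ρ := by rw [h2, mul_one, div_mul_cancel₀ _ (by positivity)]
    calc E * kappa M H u₀ * K = E * (M * K ^ 2 * A ^ (1 / 2 : ℝ)) := by rw [hκ]; ring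
      _ ≤ epsBound M ρ H u₀ * (M * K ^ 2 * A ^ (1 / 2 : ℝ)) := by gcongr
      _ = ρ := h1
  have hκ0 : 0 < E * kappa M H u₀ := by rw [hκ]; positivity
  -- From εκK ≤ ρ ≤ 1 and K > 1.
  have hq1 : E * kappa M H u₀ < 1 := by nlinarith
  have hwH : ∀ v : ballH4 d N ρ, u₀ + v.1 ∈ H4Vec d N := fun v => H4Vec_add hu₀H v.2.1
  have hwK : ∀ v : ballH4 d N ρ, normH4Vec (u₀ + v.1) ≤ K := fun v => by
    have := normH4Vec_add_le hu₀H v.2.1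
    have := v.2.2
    linarith
  have hwI : ∀ v : ballH4 d N ρ, ∀ᵐ x, evalVec (u₀ + v.1) x ∈
      Metric.closedBall (0 : Rn N) (ce * normH4Vec u₀ + ce) := fun v =>
    ae_evalVec_mem_ballI hd7 hce (hwH v) (hwK v)
  have hex : ∀ j (v : ballH4 d N ρ), ∃ u : ballH4 d N ρ,
      SolvesFrozen ε H (g j) (u₀ + v.1) u.1 := by
    intro j v
    obtain ⟨u, hu⟩ := exists_solvesFrozen hd5 hfH ε hr (hquad j) (hwI v)
    refine ⟨⟨u, fun m => (hu m).1, ?_⟩, hu⟩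
    refine (hu.normH4Vec_le hd5 hfH hε hεpos.le hr hM.le (hquad j) (hwI v) (hwK v)).trans ?_
    refine le_trans (le_of_eq ?_) hEκρ
    rw [hκ]; ring
  choose T hT using hex
  have hcontr : ∀ j (v w : ballH4 d N ρ),
      normH4Vec ((T j v).1 - (T j w).1) ≤ E * kappa M H u₀ * normH4Vec (v.1 - w.1) := by
    intro j v w
    refine ((hT j v).normH4Vec_sub_le hd5 hfH hε hεpos.le hr hM.le (hquad j) (hwI v) (hwI w)
      (hwK v) (hwK w) (hT j w)).trans_eq ?_
    rw [add_sub_add_left_eq_sub, hκ]; ring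
  have hfix : ∀ j, ∃ a, ∀ v, T j v = v ↔ v = a := fun j =>
    exists_forall_fixed_iff_ballH4 hρ0.le hκ0.le hq1 (hcontr j)
  choose up hup using hfix
  refine ⟨T, up, fun j => ⟨fun v u => ?_, ⟨_, hκ0.le, hq1, hcontr j⟩, hup j, fun m => ?_⟩, hq1, ?_⟩
  · rw [solvesAux_iff_solvesFrozen]
    refine ⟨fun h => h.unique (by omega) (hT j v), ?_⟩
    rintro rfl
    exact hT j v
  · have h1 := hT j (up j) m
    rw [(hup j (up j)).2 rfl] at h1
    -- The stationary equation is the sum of the auxiliary equation at the fixed point and the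
    -- linear equation for u₀.
    rw [Pi.add_apply, add_comm (u₀ m)]
    exact h1.add (hu₀ m)
  · rw [add_sub_add_left_eq_sub]
    have e0 : T 0 (up 0) = up 0 := (hup 0 _).2 rfl
    have e1 : T 1 (up 1) = up 1 := (hup 1 _).2 rfl
    have h1 := hcontr 0 (up 0) (up 1)
    have h2 := ((hT 0 (up 1)).sub hfH hr (hquad 0) (hquad 1) (hwI (up 1)) (hT 1 (up 1))).normH4Vec_le
      hd5 hfH hε hεpos.le hr (normC2Vec_nonneg _ _) ((hquad 0).sub hr (hquad 1)) (hwI (up 1))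
      (hwK (up 1))
    -- The intermediate point T₁u_{p,2} separates the two effects: T₁ contracts u_{p,1} - u_{p,2} by
    -- εκ, and T₁ - T₂ at u_{p,2} is controlled by g₁ - g₂. The first term is then absorbed into the
    -- left side.
    have h3 := normH4Vec_sub_le (T 0 (up 0)).2.1 (T 0 (up 1)).2.1 (T 1 (up 1)).2.1
    rw [e0, e1] at h3
    rw [e0] at h1
    rw [e1] at h2
    set X := normH4Vec ((up 0).1 - (up 1).1)
    set δ := normC2Vec (ballI ce u₀) (g 0 - g 1) with hδ
    have h4 : X * (1 - E * kappa M H u₀) ≤ E * (δ * K) * K * A ^ (1 / 2 : ℝ) := by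
      have h2' : normH4Vec ((T 0 (up 1)).1 - (up 1).1) ≤ E * (δ * K) * K * A ^ (1 / 2 : ℝ) := h2
      linarith
    have h5 : 0 < 1 - E * kappa M H u₀ := by linarith
    rw [div_mul_eq_mul_div, div_mul_eq_mul_div, le_div_iff₀ (by positivity)]
    -- The factor M appears because K A^{1/2} = κ/M.
    calc X * (M * (1 - E * kappa M H u₀)) = M * (X * (1 - E * kappa M H u₀)) := by ring
      _ ≤ M * (E * (δ * K) * K * A ^ (1 / 2 : ℝ)) := by gcongr
      _ = _ := by rw [hκ]; ring
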